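/- Let $M$ be a smooth $n$-manifold, $T\in(0,\infty]$, and let $g(t)$, $t\in[0,T)$, be a smooth family of Riemannian metrics on $M$ (smooth on $M\times[0,T)$) solving the Ricci flow $\frac{\partial}{\partial t}g_{ij}=-2R_{ij}$. In local coordinates $x^1,\dots,x^n$ on $M$ write $\Gamma_{ij}^k$ for the Christoffel symbols of $g$, $$R_{ijk}^l=\partial_i\Gamma_{jk}^l-\partial_j\Gamma_{ik}^l+\Gamma_{jk}^m\Gamma_{im}^l-\Gamma_{ik}^m\Gamma_{jm}^l,\qquad R_{jk}=R_{pjk}^p,\qquad R_i^l=g^{lm}R_{im},\qquad R=g^{jk}R_{jk},$$ $\nabla$ for the Levi-Civita connection, $\nabla^l=g^{lm}\nabla_m$ and $\Delta=g^{pq}\nabla_p\nabla_q$ (repeated indices are summed). Fix $\tau\in[0,T)$, let $\tilde M_\tau=M\times[0,T-\tau)$ with coordinates $x^0=t,x^1,\dots,x^n$, and let $\tilde\nabla_\tau$ be the connection on $T\tilde M_\tau$ whose coefficients at $(x,t)$ are, for $1\le i,j,k\le n$, $$\tilde\Gamma_{ij}^k=\Gamma_{ij}^k,\qquad \tilde\Gamma_{i0}^k=\tilde\Gamma_{0i}^k=-R_i^k,\qquad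 \tilde\Gamma_{00}^k=-\tfrac12\nabla^kR,$$ with the right hand sides evaluated at $(x,t+\tau)$, and $\tilde\Gamma_{ab}^0=0$ for $0\le a,b\le n$. Its curvature tensor is, for $0\le a,b,c,d\le n$, $$\tilde R_{abc}^d=\partial_a\tilde\Gamma_{bc}^d-\partial_b\tilde\Gamma_{ac}^d+\sum_{m=0}^n\bigl(\tilde\Gamma_{bc}^m\tilde\Gamma_{am}^d-\tilde\Gamma_{ac}^m\tilde\Gamma_{bm}^d\bigr),$$ where time derivatives at an initial time are one-sided. Theorem 2.2. For all $1\le i,j,k,l\le n$, $$\tilde R_{ijk}^l=R_{ijk}^l,\tag{B1}$$ $$\tilde R_{ijk}^0=0,\tag{B2}$$ $$\tilde R_{ij0}^l=-\nabla_iR_j^l+\nabla_jR_i^l,\tag{B3}$$ $$\tilde R_{i0k}^l=-\nabla^lR_{ik}+\nabla_kR_i^l,\tag{B4}$$ $$\begin{aligned}\tilde R_{i00}^l&=\Delta R_i^l-\tfrac12\nabla_i\nabla^lR+2g^{lm}R_{pim}^qR_q^p-R_m^lR_i^m\\&=\tfrac{\partial}{\partial t}R_i^l-\tfrac12\nabla_i\nabla^lR-R_i^mR_m^l,\end{aligned}\tag{B5}$$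 where the left hand sides are evaluated at $(x,t)\in\tilde M_\tau$ and the right hand sides at $(x,t+\tau)$. -/

import Mathlib

open scoped Manifold ContDiff

noncomputable section

namespace RicciSpacetime

/-- The half-open time interval `[0, T)`; the value `T = ⊤` is allowed. -/
def timeInterval (T : EReal) : Set ℝ := {t | 0 ≤ t ∧ (t : EReal) < T}

/-! ### Connection coefficients and their curvature, in coordinates -/

section Curvature

variable {ι X : Type*} [Fintype ι]

/-- The curvature coefficients `R_{ijk}^l = ∂_i Γ_{jk}^l - ∂_j Γ_{ik}^l + Γ_{jk}^m Γ_{im}^l -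
Γ_{ik}^m Γ_{jm}^l` (summed over `m`) of the connection whose coefficients are `Γ i j k = Γ_{ij}^k`;
`D i` is the partial derivative `∂_i` in the coordinates under consideration. -/
def curvatureCoeff (D : ι → (X → ℝ) → X → ℝ) (Γ : ι → ι → ι → X → ℝ) (i j k l : ι) (x : X) : ℝ :=
  D i (Γ j k l) x - D j (Γ i k l) x
    + ∑ m, (Γ j k m x * Γ i m l x - Γ i k m x * Γ j m l x)

end Curvature

/-! ### Riemannian geometry of one metric in local coordinates

`G y i j` is the component `g_{ij}` of the metric at the coordinate point `y`. Tensor components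
are functions of their indices and of the coordinate point; lower indices come first. -/

section Space

variable {n : ℕ}

/-- The partial derivative `∂_i f`. -/
def pd (i : Fin n) (f : EuclideanSpace ℝ (Fin n) → ℝ) (y : EuclideanSpace ℝ (Fin n)) : ℝ :=
  fderiv ℝ f y (EuclideanSpace.single i 1)

variable (G : EuclideanSpace ℝ (Fin n) → Matrix (Fin n) (Fin n) ℝ)

/-- The Christoffel symbol `Γ_{ij}^k` of the Levi-Civita connection. -/
def christoffel (i j k : Fin n) (y : EuclideanSpace ℝ (Fin n)) : ℝ :=
  (1 / 2) * ∑ l, (G y)⁻¹ k l *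
    (pd i (fun z => G z j l) y + pd j (fun z => G z i l) y - pd l (fun z => G z i j) y)

/-- The Riemann curvature tensor `R_{ijk}^l`. -/
def riem (i j k l : Fin n) (y : EuclideanSpace ℝ (Fin n)) : ℝ :=
  curvatureCoeff pd (christoffel G) i j k l y

/-- The Ricci tensor `R_{jk} = R_{pjk}^p`. -/
def ric (j k : Fin n) (y : EuclideanSpace ℝ (Fin n)) : ℝ := ∑ p, riem G p j k p y

/-- The Ricci tensor with its second index raised, `R_i^l = g^{lm} R_{im}`. -/
def ricMixed (i l : Fin n) (y : EuclideanSpace ℝ (Fin n)) : ℝ := ∑ m, (G y)⁻¹ l m * ric G i m y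

/-- The scalar curvature `R = g^{jk} R_{jk}`. -/
def scal (y : EuclideanSpace ℝ (Fin n)) : ℝ := ∑ j, ∑ k, (G y)⁻¹ j k * ric G j k y

/-- The gradient of the scalar curvature, `∇^l R = g^{lm} ∂_m R`. -/
def gradScal (l : Fin n) (y : EuclideanSpace ℝ (Fin n)) : ℝ := ∑ m, (G y)⁻¹ l m * pd m (scal G) y

/-- The covariant derivative `∇_i V^l` of a vector field. -/
def covVec (V : Fin n → EuclideanSpace ℝ (Fin n) → ℝ) (i l : Fin n)
    (y : EuclideanSpace ℝ (Fin n)) : ℝ :=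
  pd i (V l) y + ∑ m, christoffel G i m l y * V m y

/-- The covariant derivative `∇_i A_{jk}` of a tensor field with two lower indices. -/
def cov02 (A : Fin n → Fin n → EuclideanSpace ℝ (Fin n) → ℝ) (i j k : Fin n)
    (y : EuclideanSpace ℝ (Fin n)) : ℝ :=
  pd i (A j k) y - ∑ m, christoffel G i j m y * A m k y - ∑ m, christoffel G i k m y * A j m y

/-- The covariant derivative `∇_i A_j^l` of a tensor field with one lower and one upper index. -/
def cov11 (A : Fin n → Fin n → EuclideanSpace ℝ (Fin n) → ℝ) (i j l : Fin n)
    (y : EuclideanSpace ℝ (Fin n)) : ℝ :=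
  pd i (A j l) y - ∑ m, christoffel G i j m y * A m l y + ∑ m, christoffel G i m l y * A j m y

/-- The covariant derivative `∇_i B_{jk}^l` of a tensor field with two lower and one upper
index. -/
def cov21 (B : Fin n → Fin n → Fin n → EuclideanSpace ℝ (Fin n) → ℝ) (i j k l : Fin n)
    (y : EuclideanSpace ℝ (Fin n)) : ℝ :=
  pd i (B j k l) y - ∑ m, christoffel G i j m y * B m k l y
    - ∑ m, christoffel G i k m y * B j m l y + ∑ m, christoffel G i m l y * B j k m y

/-- `∇^l R_{ik} = g^{lm} ∇_m R_{ik}`. -/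
def covUpRic (l i k : Fin n) (y : EuclideanSpace ℝ (Fin n)) : ℝ :=
  ∑ m, (G y)⁻¹ l m * cov02 G (ric G) m i k y

/-- The rough Laplacian of the Ricci tensor, `Δ R_i^l = g^{pq} ∇_p ∇_q R_i^l`. -/
def lapRic (i l : Fin n) (y : EuclideanSpace ℝ (Fin n)) : ℝ :=
  ∑ p, ∑ q, (G y)⁻¹ p q * cov21 G (cov11 G (ricMixed G)) p q i l y

end Space

/-! ### Families of metrics on a manifold and the Ricci flow -/

section Manifold

variable {n : ℕ} {M : Type*} [TopologicalSpace M] [ChartedSpace (EuclideanSpace ℝ (Fin n)) M]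
  [IsManifold (𝓡 n) ∞ M]

/-- A smooth Riemannian metric on the smooth `n`-manifold `M`. -/
abbrev SmoothMetric (n : ℕ) (M : Type*) [TopologicalSpace M]
    [ChartedSpace (EuclideanSpace ℝ (Fin n)) M] [IsManifold (𝓡 n) ∞ M] :=
  Bundle.ContMDiffRiemannianMetric (𝓡 n) ∞ (EuclideanSpace ℝ (Fin n))
    (fun x : M => TangentSpace (𝓡 n) x)

/-- The coordinate vector field `∂/∂x^i` of the chart `e`, at the point with coordinates `y`. -/
def coordVec (e : OpenPartialHomeomorph M (EuclideanSpace ℝ (Fin n)))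
    (i : Fin n) (y : EuclideanSpace ℝ (Fin n)) : TangentSpace (𝓡 n) (e.symm y) :=
  mfderiv (𝓡 n) (𝓡 n) e.symm y (EuclideanSpace.single i 1 : EuclideanSpace ℝ (Fin n))

/-- The matrix of components `g_{ij} = g(∂/∂x^i, ∂/∂x^j)` in the chart `e`. -/
def metricCoeff (e : OpenPartialHomeomorph M (EuclideanSpace ℝ (Fin n))) (g : SmoothMetric n M)
    (y : EuclideanSpace ℝ (Fin n)) : Matrix (Fin n) (Fin n) ℝ :=
  Matrix.of fun i j => g.inner (e.symm y) (coordVec e i y) (coordVec e j y)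

/-- `g t`, `t ∈ [0, T)`, is a solution of the Ricci flow on `M`: in all smooth charts, the
components `g_{ij}` are smooth functions on `M × [0, T)` and satisfy `∂g_{ij}/∂t = -2 R_{ij}`
(a one-sided derivative at `t = 0`). The values of `g` outside `[0, T)` play no role. -/
structure IsRicciFlow (T : EReal) (g : ℝ → SmoothMetric n M) : Prop where
  smooth : ∀ e ∈ IsManifold.maximalAtlas (𝓡 n) ∞ M, ∀ i j : Fin n,
    ContDiffOn ℝ ∞ (fun p : EuclideanSpace ℝ (Fin n) × ℝ => metricCoeff e (g p.2) p.1 i j)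
      (e.target ×ˢ timeInterval T)
  evolution : ∀ e ∈ IsManifold.maximalAtlas (𝓡 n) ∞ M, ∀ y ∈ e.target, ∀ t ∈ timeInterval T,
    ∀ i j : Fin n, HasDerivWithinAt (fun s => metricCoeff e (g s) y i j)
      (-2 * ric (metricCoeff e (g t)) i j y) (timeInterval T) t

end Manifold

/-! ### The space-time connection

Points of space-time are written `(y, t)` in coordinates. The coordinates are indexed by
`Fin (n + 1)`: the index `0` is the time coordinate `x⁰ = t`, and the spatial index `i` is
`i.succ`. -/

section Spacetime

variable {n : ℕ}

/-- The partial derivative `∂_a` on space-time with time interval `J`; the time derivative is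
one-sided at an end point of `J`. -/
def stPd (J : Set ℝ) (a : Fin (n + 1)) (f : EuclideanSpace ℝ (Fin n) × ℝ → ℝ)
    (p : EuclideanSpace ℝ (Fin n) × ℝ) : ℝ :=
  Fin.cases (derivWithin (fun s => f (p.1, s)) J p.2) (fun i => pd i (fun z => f (z, p.2)) p.1) a

/-- The coefficients `Γ̃_{ab}^c` of the space-time connection with time shift `τ`, for the family
of metrics with components `G t y i j = g_{ij}(y, t)`:
`Γ̃_{ij}^k = Γ_{ij}^k`, `Γ̃_{i0}^k = Γ̃_{0i}^k = -R_i^k`, `Γ̃_{00}^k = -½ ∇^k R` for spatial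
`i, j, k`, and `Γ̃_{ab}^0 = 0` for all `a, b`, where the right hand sides are taken at time
`t + τ`. -/
def stGamma (G : ℝ → EuclideanSpace ℝ (Fin n) → Matrix (Fin n) (Fin n) ℝ) (τ : ℝ)
    (a b c : Fin (n + 1)) (p : EuclideanSpace ℝ (Fin n) × ℝ) : ℝ :=
  Fin.cases 0
    (fun k => Fin.cases
      (Fin.cases
        (-(1 / 2) * gradScal (G (p.2 + τ)) k p.1)
        (fun j => -ricMixed (G (p.2 + τ)) j k p.1) b)
      (fun i => Fin.cases
        (-ricMixed (G (p.2 + τ)) i k p.1)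
        (fun j => christoffel (G (p.2 + τ)) i j k p.1) b) a) c

/-- The curvature coefficients `R̃_{abc}^d` of the space-time connection on
`M × [0, T - τ)`. -/
def stRiem (T : EReal) (G : ℝ → EuclideanSpace ℝ (Fin n) → Matrix (Fin n) (Fin n) ℝ) (τ : ℝ)
    (a b c d : Fin (n + 1)) (p : EuclideanSpace ℝ (Fin n) × ℝ) : ℝ :=
  curvatureCoeff (stPd (timeInterval (T - (τ : EReal)))) (stGamma G τ) a b c d p

end Spacetime

end RicciSpacetime

end

set_option linter.unusedSectionVars false

noncomputable section

namespace RicciSpacetime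

/-! ### Tensor calculus over an algebra with commuting derivations -/

section Algebra

variable {ι A W W' : Type*} [Fintype ι] [CommRing A] [Algebra ℝ A]
  [AddCommGroup W] [Module A W] [AddCommGroup W'] [Module A W']

/-! Split the space-time coefficients into the spatial part Γ, the mixed part P = -Ric and the
temporal part N = -½∇R. Since every coefficient with upper index 0 vanishes, the curvature formula
collapses: the spatial components are the curvature of Γ, the components with upper index 0 are
zero, and R̃_{ij0}^l = ∇_i P_j^l - ∇_j P_i^l, R̃_{i0k}^l = ∇_i P_k^l - ∂_t Γ_{ik}^l, R̃_{i00}^l =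
∇_i N^l - ∂_t P_i^l - P_i^m P_m^l (the `curv_stCoeff` lemmas). The flow equation enters only through
two evolution formulas.

The formula ∂_t Γ_{ij}^l = g^{lm}(-∇_i R_{jm} - ∇_j R_{im} + ∇_m R_{ij}) (`flow_connection`) is the
time derivative of ∇g = 0, solved for ∂_t Γ by the permutation of indices familiar from the Koszul
formula. It settles R̃_{i0k}^l. Inserted in the variation of the curvature (`curv_variation`) and
traced, it gives ∂_t Ric; commuting covariant derivatives (`metricTrace_ddRicci`, from the Ricci
identity and the contracted second Bianchi identity) turns this into ∂_t R_i^l = ΔR_i^l + 2 g^{lm}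
R_{pim}^q R_q^p (`flow_ricciUp`), which links the two expressions for R̃_{i00}^l.

All of this is algebra over a commutative ℝ-algebra with commuting derivations. The algebra used is
`smoothFun (U ×ˢ J)`, where U is the chart target and J = [0, T), with the derivations ∂_i and ∂_t.
One-sided time derivatives are built into it, so t = 0 is not a special case. `Represents` ties its
elements to the coordinate expressions, and evaluation at a point gives the theorem. -/

/-- A covariant differentiation in the coordinate directions on the `A`-module `W`, over the
derivations `d`. -/
structure CovDeriv (d : ι → Derivation ℝ A A) (W : Type*) [AddCommGroup W] [Module A W] where
  /-- The covariant derivative in the direction `i`. -/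
  D : ι → W →+ W
  leibniz : ∀ i (a : A) w, D i (a • w) = d i a • w + a • D i w

variable {d : ι → Derivation ℝ A A} (Γ : ι → ι → ι → A)

/-- The derivations themselves, acting on functions. -/
def CovDeriv.base (d : ι → Derivation ℝ A A) : CovDeriv d A where
  D i := (d i : A →ₗ[ℝ] A).toAddMonoidHom
  leibniz i a w := by simp [mul_comm, add_comm]

@[simp] theorem CovDeriv.base_apply (i : ι) (a : A) : (CovDeriv.base d).D i a = d i a := rfl

theorem CovDeriv.map_real_smul [Module ℝ W] [IsScalarTower ℝ A W] (c : CovDeriv d W) (i : ι)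
    (r : ℝ) (w : W) : c.D i (r • w) = r • c.D i w := by
  rw [← algebraMap_smul A r w, c.leibniz, Derivation.map_algebraMap, zero_smul, zero_add,
    algebraMap_smul]

/-- The induced covariant differentiation on tensors with one more lower index. -/
def CovDeriv.lower (c : CovDeriv d W) : CovDeriv d (ι → W) where
  D i := AddMonoidHom.mk' (fun T j => c.D i (T j) - ∑ m, Γ i j m • T m) fun S T => by
    funext j
    simp only [Pi.add_apply, map_add, smul_add, Finset.sum_add_distrib]
    abel
  leibniz i a w := by
    funext j
    simp only [AddMonoidHom.mk'_apply, Pi.add_apply, Pi.smul_apply, c.leibniz, smul_sub,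
      Finset.smul_sum, smul_comm a]
    abel

theorem CovDeriv.lower_apply (c : CovDeriv d W) (i j : ι) (T : ι → W) :
    (c.lower Γ).D i T j = c.D i (T j) - ∑ m, Γ i j m • T m := rfl

/-- The induced covariant differentiation on tensors with one more upper index. -/
def CovDeriv.upper (c : CovDeriv d W) : CovDeriv d (ι → W) where
  D i := AddMonoidHom.mk' (fun T l => c.D i (T l) + ∑ m, Γ i m l • T m) fun S T => by
    funext j
    simp only [Pi.add_apply, map_add, smul_add, Finset.sum_add_distrib]
    abel
  leibniz i a w := by
    funext j
    simp only [AddMonoidHom.mk'_apply, Pi.add_apply, Pi.smul_apply, c.leibniz, smul_add,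
      Finset.smul_sum, smul_comm a]
    abel

theorem CovDeriv.upper_apply (c : CovDeriv d W) (i l : ι) (T : ι → W) :
    (c.upper Γ).D i T l = c.D i (T l) + ∑ m, Γ i m l • T m := rfl

/-- A parallel linear map stays parallel when it is applied under one more lower index. -/
theorem CovDeriv.lower_map (c : CovDeriv d W) (c' : CovDeriv d W') (f : W →ₗ[A] W')
    (hf : ∀ i w, c'.D i (f w) = f (c.D i w)) (i : ι) (T : ι → W) :
    (c'.lower Γ).D i (fun j => f (T j)) = fun j => f ((c.lower Γ).D i T j) := by
  funext j
  simp only [CovDeriv.lower_apply, hf, map_sub, map_sum, map_smul]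

/-- The curvature `R_{ijk}^l` of the connection coefficients `Γ`. -/
def curv (d : ι → Derivation ℝ A A) (i j k l : ι) : A :=
  d i (Γ j k l) - d j (Γ i k l) + ∑ m, (Γ j k m * Γ i m l - Γ i k m * Γ j m l)

variable {Γ}

theorem curv_antisymm (i j k l : ι) : curv Γ d j i k l = -curv Γ d i j k l := by
  simp only [curv, Finset.sum_sub_distrib]
  ring

/-- The Ricci identity, for one more lower index. -/
theorem CovDeriv.lower_commutator (c : CovDeriv d W) (i j : ι) (F : W → W) (hF : ∀ w, c.D i (c.D j w) - c.D j (c.D i w) = -F w) (T : ι → W) (k : ι) :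
    (c.lower Γ).D i ((c.lower Γ).D j T) k - (c.lower Γ).D j ((c.lower Γ).D i T) k
      = -(F (T k) + ∑ m, curv Γ d i j k m • T m) := by
  have h : ∀ (a b : ι → ι → A), ∑ m, a k m • ∑ m', b m m' • T m'
      = ∑ m, (∑ m', a k m' * b m' m) • T m := by
    intro a b
    simp only [Finset.smul_sum, smul_smul, Finset.sum_smul]
    exact Finset.sum_comm
  simp only [CovDeriv.lower_apply, map_sub, map_sum, c.leibniz, smul_sub, Finset.sum_sub_distrib,
    Finset.sum_add_distrib, h (Γ i) (Γ j), h (Γ j) (Γ i)]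
  have h' := hF (T k)
  simp only [curv, add_smul, sub_smul, Finset.sum_add_distrib, Finset.sum_sub_distrib]
  rw [neg_add, ← h']
  abel

theorem CovDeriv.base_commutator (hd : ∀ i j a, d i (d j a) = d j (d i a)) (i j : ι) (a : A) :
    (base d).D i ((base d).D j a) - (base d).D j ((base d).D i a) = -(0 : A) := by
  simp [hd i j]

/-- The second covariant derivative is symmetric up to curvature. -/
theorem CovDeriv.second_sub (c : CovDeriv d W) (hΓ : ∀ i j k, Γ i j k = Γ j i k) (i j : ι) (w : W) :
    (c.lower Γ).D i (fun k => c.D k w) j - (c.lower Γ).D j (fun k => c.D k w) i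
      = c.D i (c.D j w) - c.D j (c.D i w) := by
  simp only [CovDeriv.lower_apply, hΓ j i]
  abel

/-- The first Bianchi identity. -/
theorem curv_bianchi (hΓ : ∀ i j k, Γ i j k = Γ j i k) (i j k l : ι) :
    curv Γ d i j k l + curv Γ d j k i l + curv Γ d k i j l = 0 := by
  simp only [curv, Finset.sum_sub_distrib, hΓ j i, hΓ k i, hΓ k j]
  ring

/-- The second Bianchi identity. -/
theorem curv_second_bianchi (hd : ∀ i j a, d i (d j a) = d j (d i a))
    (hΓ : ∀ i j k, Γ i j k = Γ j i k) (p i j k l : ι) :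
    let D := ((((CovDeriv.base d).upper Γ).lower Γ).lower Γ).lower Γ
    D.D p (curv Γ d) i j k l + D.D i (curv Γ d) j p k l + D.D j (curv Γ d) p i k l = 0 := by
  intro D
  -- In terms of the matrices M_i = (Γ_{ij}^k)_{jk} the curvature is K_{ij} = ∂_i M_j - ∂_j M_i +
  -- [M_j, M_i], and the cyclic sum of ∂_p K_{ij} + [K_{ij}, M_p] vanishes by expansion in a
  -- noncommutative ring.
  let M : ι → Matrix ι ι A := fun i => Matrix.of (Γ i)
  let K : ι → ι → Matrix ι ι A := fun i j => Matrix.of (curv Γ d i j)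
  have hmul : ∀ (i : ι) (X Y : Matrix ι ι A),
      (X * Y).map (d i) = X.map (d i) * Y + X * Y.map (d i) := by
    intro i X Y
    ext a b
    simp only [Matrix.map_apply, Matrix.mul_apply, Matrix.add_apply, map_sum, Derivation.leibniz,
      smul_eq_mul, ← Finset.sum_add_distrib]
    exact Finset.sum_congr rfl fun _ _ => by ring
  have hK : ∀ i j, K i j = (M j).map (d i) - (M i).map (d j) + M j * M i - M i * M j := by
    intro i j
    ext a b
    simp only [K, M, Matrix.of_apply, curv, Matrix.sub_apply, Matrix.add_apply, Matrix.map_apply,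
      Matrix.mul_apply, Finset.sum_sub_distrib]
    ring
  have hE : ∀ p i j, (K i j).map (d p) + K i j * M p - M p * K i j
      + ((K j p).map (d i) + K j p * M i - M i * K j p)
      + ((K p i).map (d j) + K p i * M j - M j * K p i) = 0 := by
    intro p i j
    have hadd : ∀ (i : ι) (X Y : Matrix ι ι A), (X + Y).map (d i) = X.map (d i) + Y.map (d i) :=
      fun i X Y => by ext; simp
    have hsub : ∀ (i : ι) (X Y : Matrix ι ι A), (X - Y).map (d i) = X.map (d i) - Y.map (d i) :=
      fun i X Y => by ext; simp
    have hcomm : ∀ (i j : ι) (X : Matrix ι ι A), (X.map (d j)).map (d i) = (X.map (d i)).map (d j) :=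
      fun i j X => by ext; simp [hd i j]
    simp only [hK, hadd, hsub, hmul]
    rw [hcomm i p, hcomm j p, hcomm j i]
    noncomm_ring
  have hX : ∀ p i j, D.D p (curv Γ d) i j k l
      = ((K i j).map (d p) + K i j * M p - M p * K i j) k l
        - ∑ m, Γ p i m * curv Γ d m j k l - ∑ m, Γ p j m * curv Γ d i m k l := by
    intro p i j
    simp only [D, CovDeriv.lower_apply, CovDeriv.upper_apply, CovDeriv.base_apply, Pi.sub_apply,
      Finset.sum_apply, Pi.smul_apply, smul_eq_mul, Matrix.add_apply, Matrix.sub_apply,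
      Matrix.map_apply, Matrix.mul_apply, K, M, Matrix.of_apply]
    rw [Finset.sum_congr rfl fun m _ => mul_comm (Γ p m l) (curv Γ d i j k m)]
    ring
  have h := congrFun (congrFun (hE p i j) k) l
  simp only [Matrix.add_apply, Matrix.zero_apply] at h
  -- The remaining Christoffel terms act on the two antisymmetric indices; they cancel in pairs
  -- because Γ has no torsion.
  have ha : ∀ a b c, ∑ m, Γ a b m * curv Γ d m c k l = -∑ m, Γ b a m * curv Γ d c m k l := by
    intro a b c
    rw [← Finset.sum_neg_distrib]
    exact Finset.sum_congr rfl fun m _ => by rw [curv_antisymm c m, hΓ a b]; ring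
  rw [hX, hX, hX, ha p i j, ha i j p, ha j p i]
  linear_combination h

/-- The variation of the curvature. -/
theorem curv_variation (δ : Derivation ℝ A A) (hδ : ∀ i a, δ (d i a) = d i (δ a))
    (hΓ : ∀ i j k, Γ i j k = Γ j i k) (i j k l : ι) :
    let D := (((CovDeriv.base d).upper Γ).lower Γ).lower Γ
    let C : ι → ι → ι → A := fun i j k => δ (Γ i j k)
    δ (curv Γ d i j k l) = D.D i C j k l - D.D j C i k l := by
  intro D C
  -- The Christoffel terms on the differentiation slot, Γ_{ij}^m C_{mk}^l and Γ_{ji}^m C_{mk}^l,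
  -- cancel by the symmetry of Γ.
  simp only [D, C, curv, CovDeriv.lower_apply, CovDeriv.upper_apply, CovDeriv.base_apply,
    Pi.sub_apply, Finset.sum_apply, Pi.smul_apply, smul_eq_mul, map_add, map_sub, map_sum,
    Derivation.leibniz, hδ, hΓ j i, Finset.sum_add_distrib, Finset.sum_sub_distrib]
  ring

end Algebra

/-! ### Metric contractions and the Levi-Civita connection -/

section Metric

variable {ι A W : Type*} [Fintype ι] [DecidableEq ι] [CommRing A] [Algebra ℝ A]
  [AddCommGroup W] [Module A W]

/-- `A` is not a field; the factor 2 is cancelled by the scalar 1/2 of the ℝ-algebra. -/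
theorem eq_zero_of_two_mul {a : A} (h : 2 * a = 0) : a = 0 := by
  have h' : a = (1 / 2 : ℝ) • (2 * a) := by
    rw [two_mul, ← two_smul ℝ a, smul_smul]
    norm_num
  rw [h', h, smul_zero]

/-- `Γ` is the Levi-Civita connection of the metric `g`, whose inverse is `gi`. -/
structure IsLeviCivita (d : ι → Derivation ℝ A A) (g gi : Matrix ι ι A) (Γ : ι → ι → ι → A) :
    Prop where
  comm : ∀ i j a, d i (d j a) = d j (d i a)
  symm : ∀ i j k, Γ i j k = Γ j i k
  metric_symm : ∀ i j, g i j = g j i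
  inv_mul : gi * g = 1
  compat : ∀ i j k, d i (g j k) = ∑ m, Γ i j m * g m k + ∑ m, Γ i k m * g j m

/-- The linear map that applies the matrix `N` to the first index. -/
def applyMatrix (N : Matrix ι ι A) : (ι → W) →ₗ[A] (ι → W) where
  toFun T l := ∑ m, N l m • T m
  map_add' S T := by
    funext l
    simp [Finset.sum_add_distrib]
  map_smul' a T := by
    funext l
    simp [Finset.smul_sum, smul_comm a]

theorem applyMatrix_apply (N : Matrix ι ι A) (T : ι → W) (l : ι) :
    applyMatrix N T l = ∑ m, N l m • T m := rfl

theorem applyMatrix_mul (M N : Matrix ι ι A) (T : ι → W) :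
    applyMatrix M (applyMatrix N T) = applyMatrix (M * N) T := by
  funext l
  simp only [applyMatrix_apply, Matrix.mul_apply, Finset.smul_sum, Finset.sum_smul, smul_smul]
  exact Finset.sum_comm

theorem applyMatrix_one (T : ι → W) : applyMatrix (1 : Matrix ι ι A) T = T := by
  funext l
  simp [applyMatrix_apply, Matrix.one_apply]

/-- The trace of a tensor with one lower and one upper index. -/
def contract : (ι → ι → W) →ₗ[A] W where
  toFun T := ∑ p, T p p
  map_add' S T := by simp [Finset.sum_add_distrib]
  map_smul' a T := by simp [Finset.smul_sum]

/-- The metric trace of a tensor with two lower indices. -/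
def metricTrace (gi : Matrix ι ι A) : (ι → ι → W) →ₗ[A] W where
  toFun T := ∑ p, ∑ q, gi p q • T p q
  map_add' S T := by simp [Finset.sum_add_distrib]
  map_smul' a T := by simp [Finset.smul_sum, smul_comm a]

theorem metricTrace_apply (gi : Matrix ι ι A) (T : ι → ι → W) :
    metricTrace gi T = ∑ p, ∑ q, gi p q • T p q := rfl

/-- Splits the metric trace into raising an index and a plain contraction, so that it is parallel as
soon as both of these are. -/
theorem metricTrace_eq_contract (gi : Matrix ι ι A) (T : ι → ι → W) :
    metricTrace gi T = contract (A := A) fun p => applyMatrix gi (T p) := rfl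

variable {d : ι → Derivation ℝ A A} {g gi : Matrix ι ι A} {Γ : ι → ι → ι → A}

/-- The Christoffel terms of the lower and of the upper index have opposite signs and cancel after
renaming the summation indices; no metric is involved. -/
theorem CovDeriv.contract_parallel (c : CovDeriv d W) (i : ι) (T : ι → ι → W) :
    c.D i (contract (A := A) T) = contract (A := A) (((c.upper Γ).lower Γ).D i T) := by
  have h : ∑ p, ∑ m, Γ i p m • T m p = ∑ p, ∑ m, Γ i m p • T p m := Finset.sum_comm
  simp only [contract, LinearMap.coe_mk, AddHom.coe_mk, CovDeriv.lower_apply, Pi.sub_apply,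
    Finset.sum_apply, Pi.smul_apply, CovDeriv.upper_apply, map_sum, Finset.sum_sub_distrib,
    Finset.sum_add_distrib, h]
  abel

/-- The Ricci identity for tensors with two lower indices. -/
theorem CovDeriv.commutator_two (hd : ∀ i j a, d i (d j a) = d j (d i a)) (T : ι → ι → A)
    (i j k l : ι) :
    let c := ((CovDeriv.base d).lower Γ).lower Γ
    c.D i (c.D j T) k l - c.D j (c.D i T) k l
      = -(∑ m, curv Γ d i j l m * T k m + ∑ m, curv Γ d i j k m * T m l) := by
  intro c
  have h := CovDeriv.lower_commutator (Γ := Γ) ((CovDeriv.base d).lower Γ) i j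
    (fun θ k => 0 + ∑ m, curv Γ d i j k m • θ m)
    (fun w => funext fun k => CovDeriv.lower_commutator (Γ := Γ) (CovDeriv.base d) i j
      (fun _ => 0) (CovDeriv.base_commutator hd i j) w k) T k
  have h' := congrFun h l
  simpa only [Pi.sub_apply, Pi.neg_apply, Pi.add_apply, Finset.sum_apply, Pi.smul_apply,
    smul_eq_mul, zero_add] using h'

namespace IsLeviCivita

variable (h : IsLeviCivita d g gi Γ)
include h

theorem mul_inv : g * gi = 1 := mul_eq_one_comm.mp h.inv_mul

theorem inv_symm (i j : ι) : gi i j = gi j i := by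
  have hg : g.transpose = g := by
    ext i j
    exact h.metric_symm j i
  have h1 : gi.transpose * g = 1 := by
    have := congrArg Matrix.transpose h.mul_inv
    rwa [Matrix.transpose_mul, hg, Matrix.transpose_one] at this
  have h2 : gi.transpose = gi := by
    calc gi.transpose = gi.transpose * (g * gi) := by rw [h.mul_inv, mul_one]
      _ = gi := by rw [← mul_assoc, h1, one_mul]
  exact congrFun (congrFun h2 j) i

/-- A derivation applied to the inverse metric. -/
theorem derivation_inv (δ : Derivation ℝ A A) :
    gi.map δ = -(gi * g.map δ * gi) := by
  have h1 : (gi * g).map δ = gi.map δ * g + gi * g.map δ := by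
    ext a b
    simp only [Matrix.map_apply, Matrix.mul_apply, Matrix.add_apply, map_sum, Derivation.leibniz,
      smul_eq_mul, ← Finset.sum_add_distrib]
    exact Finset.sum_congr rfl fun _ _ => by ring
  have h2 : (gi * g).map δ = 0 := by
    rw [h.inv_mul]
    ext a b
    by_cases hab : a = b <;> simp [hab]
  have h3 : gi.map δ * g = -(gi * g.map δ) := by
    rw [h2] at h1
    exact eq_neg_of_add_eq_zero_left h1.symm
  calc gi.map δ = gi.map δ * g * gi := by rw [mul_assoc, h.mul_inv, mul_one]
    _ = _ := by rw [h3, neg_mul]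

/-- This is ∇g⁻¹ = 0 in coordinates: substitute ∂_i g = Γ_i g + g Γ_iᵀ in ∂_i g⁻¹ = -g⁻¹ (∂_i g)
g⁻¹. -/
theorem deriv_inv (i p q : ι) :
    d i (gi p q) = -(∑ m, gi p m * Γ i m q) - ∑ m, Γ i m p * gi m q := by
  have hg : g.map (d i) = Matrix.of (Γ i) * g + g * (Matrix.of (Γ i)).transpose := by
    ext j k
    simp only [Matrix.map_apply, Matrix.add_apply, Matrix.mul_apply, Matrix.of_apply,
      Matrix.transpose_apply, h.compat i j k, mul_comm (g j _)]
  have h1 : gi.map (d i) = -(gi * Matrix.of (Γ i)) - (Matrix.of (Γ i)).transpose * gi := by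
    rw [h.derivation_inv, hg]
    calc _ = -(gi * Matrix.of (Γ i) * (g * gi))
          - (gi * g) * (Matrix.of (Γ i)).transpose * gi := by noncomm_ring
      _ = _ := by rw [h.mul_inv, h.inv_mul, mul_one, one_mul]
  have h2 := congrFun (congrFun h1 p) q
  simpa only [Matrix.map_apply, Matrix.sub_apply, Matrix.neg_apply, Matrix.mul_apply,
    Matrix.of_apply, Matrix.transpose_apply] using h2

/-- Raising an index commutes with covariant differentiation. -/
theorem sharp_parallel (c : CovDeriv d W) (i : ι) (T : ι → W) :
    (c.upper Γ).D i (applyMatrix gi T) = applyMatrix gi ((c.lower Γ).D i T) := by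
  funext l
  simp only [applyMatrix_apply, CovDeriv.upper_apply, CovDeriv.lower_apply, map_sum, c.leibniz,
    h.deriv_inv, smul_sub, Finset.smul_sum, smul_smul, sub_smul, neg_smul, Finset.sum_smul,
    Finset.sum_add_distrib, Finset.sum_sub_distrib, Finset.sum_neg_distrib]
  rw [Finset.sum_comm (f := fun x y => (gi l y * Γ i y x) • T x),
    Finset.sum_comm (f := fun x y => (Γ i y l * gi y x) • T x)]
  abel

/-- Lowering an index commutes with covariant differentiation. -/
theorem flat_parallel (c : CovDeriv d W) (i : ι) (T : ι → W) :
    (c.lower Γ).D i (applyMatrix g T) = applyMatrix g ((c.upper Γ).D i T) := by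
  funext l
  simp only [applyMatrix_apply, CovDeriv.upper_apply, CovDeriv.lower_apply, map_sum, c.leibniz,
    h.compat, smul_add, Finset.smul_sum, smul_smul, add_smul, Finset.sum_smul,
    Finset.sum_add_distrib]
  rw [Finset.sum_comm (f := fun x y => (Γ i l y * g y x) • T x),
    Finset.sum_comm (f := fun x y => (Γ i x y * g l y) • T x)]
  simp only [mul_comm (g l _)]
  abel

/-- The metric trace commutes with covariant differentiation. -/
theorem metricTrace_parallel (c : CovDeriv d W) (i : ι) (T : ι → ι → W) :
    c.D i (metricTrace gi T) = metricTrace gi (((c.lower Γ).lower Γ).D i T) := by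
  rw [metricTrace_eq_contract, CovDeriv.contract_parallel (Γ := Γ),
    CovDeriv.lower_map (Γ := Γ) (c.lower Γ) (c.upper Γ) (applyMatrix gi) (h.sharp_parallel c)]
  rfl

theorem metricTrace_swap (T : ι → ι → W) :
    metricTrace gi (fun p q => T q p) = metricTrace gi T := by
  simp only [metricTrace_apply]
  rw [Finset.sum_comm]
  simp only [h.inv_symm]

theorem sharp_flat (T : ι → W) : applyMatrix gi (applyMatrix g T) = T := by
  rw [applyMatrix_mul, h.inv_mul, applyMatrix_one]

end IsLeviCivita

end Metric

/-! ### Symmetries of the curvature and the contracted Bianchi identity -/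

section RicciCurvature

variable {ι A W : Type*} [Fintype ι] [DecidableEq ι] [CommRing A] [Algebra ℝ A]
  [AddCommGroup W] [Module A W]
  {d : ι → Derivation ℝ A A} {g gi : Matrix ι ι A} {Γ : ι → ι → ι → A}

/-- Covariant differentiation of tensors with two lower indices. -/
abbrev CovDeriv.lower2 (d : ι → Derivation ℝ A A) (Γ : ι → ι → ι → A) : CovDeriv d (ι → ι → A) :=
  ((CovDeriv.base d).lower Γ).lower Γ

/-- Covariant differentiation of tensors with three lower indices. -/
abbrev CovDeriv.lower3 (d : ι → Derivation ℝ A A) (Γ : ι → ι → ι → A) :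
    CovDeriv d (ι → ι → ι → A) :=
  (CovDeriv.lower2 d Γ).lower Γ

/-- Covariant differentiation of tensors with four lower indices. -/
abbrev CovDeriv.lower4 (d : ι → Derivation ℝ A A) (Γ : ι → ι → ι → A) :
    CovDeriv d (ι → ι → ι → ι → A) :=
  (CovDeriv.lower3 d Γ).lower Γ

theorem CovDeriv.lower2_apply (i j k : ι) (T : ι → ι → A) :
    (lower2 d Γ).D i T j k
      = d i (T j k) - ∑ m, Γ i k m * T j m - ∑ m, Γ i j m * T m k := by
  simp only [CovDeriv.lower_apply, CovDeriv.base_apply, Pi.sub_apply, Finset.sum_apply,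
    Pi.smul_apply, smul_eq_mul]

theorem CovDeriv.lower3_apply (i j k l : ι) (T : ι → ι → ι → A) :
    (lower3 d Γ).D i T j k l
      = d i (T j k l) - ∑ m, Γ i l m * T j k m - ∑ m, Γ i k m * T j m l
        - ∑ m, Γ i j m * T m k l := by
  simp only [CovDeriv.lower_apply, CovDeriv.base_apply, Pi.sub_apply, Finset.sum_apply,
    Pi.smul_apply, smul_eq_mul]

theorem CovDeriv.lower4_apply (i j k l r : ι) (T : ι → ι → ι → ι → A) :
    (lower4 d Γ).D i T j k l r
      = d i (T j k l r) - ∑ m, Γ i r m * T j k l m - ∑ m, Γ i l m * T j k m r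
        - ∑ m, Γ i k m * T j m l r - ∑ m, Γ i j m * T m k l r := by
  simp only [CovDeriv.lower_apply, CovDeriv.base_apply, Pi.sub_apply, Finset.sum_apply,
    Pi.smul_apply, smul_eq_mul]

/-- The curvature tensor with all indices lowered. -/
def riemLow (d : ι → Derivation ℝ A A) (g : Matrix ι ι A) (Γ : ι → ι → ι → A) (i j k l : ι) : A :=
  ∑ m, g l m * curv Γ d i j k m

/-- The Ricci tensor of the connection coefficients `Γ`. -/
def ricci (d : ι → Derivation ℝ A A) (Γ : ι → ι → ι → A) (j k : ι) : A := ∑ p, curv Γ d p j k p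

/-- The Ricci tensor with its second index raised. -/
def ricciUp (d : ι → Derivation ℝ A A) (gi : Matrix ι ι A) (Γ : ι → ι → ι → A) (i l : ι) : A :=
  ∑ m, gi l m * ricci d Γ i m

/-- The scalar curvature. -/
def scalarCurv (d : ι → Derivation ℝ A A) (gi : Matrix ι ι A) (Γ : ι → ι → ι → A) : A :=
  ∑ j, ∑ k, gi j k * ricci d Γ j k

/-- The covariant derivative `∇_i R_{jk}`. -/
abbrev dRicci (d : ι → Derivation ℝ A A) (Γ : ι → ι → ι → A) (i j k : ι) : A :=
  (CovDeriv.lower2 d Γ).D i (ricci d Γ) j k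

/-- The covariant derivative `∇_p R_{ijkl}`. -/
abbrev dRiemLow (d : ι → Derivation ℝ A A) (g : Matrix ι ι A) (Γ : ι → ι → ι → A)
    (p i j k l : ι) : A :=
  (CovDeriv.lower4 d Γ).D p (riemLow d g Γ) i j k l

namespace IsLeviCivita

variable (h : IsLeviCivita d g gi Γ)
include h

theorem riemLow_antisymm_left (i j k l : ι) : riemLow d g Γ j i k l = -riemLow d g Γ i j k l := by
  simp only [riemLow, curv_antisymm i j, mul_neg, Finset.sum_neg_distrib]

theorem riemLow_bianchi (i j k l : ι) :
    riemLow d g Γ i j k l + riemLow d g Γ j k i l + riemLow d g Γ k i j l = 0 := by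
  simp only [riemLow, ← Finset.sum_add_distrib, ← mul_add, curv_bianchi h.symm, mul_zero,
    Finset.sum_const_zero]

theorem metric_parallel (i : ι) : (CovDeriv.lower2 d Γ).D i (fun j k => g j k) = 0 := by
  funext j k
  rw [CovDeriv.lower2_apply, h.compat]
  simp

/-- The Ricci identity applied to the parallel tensor g: its commutator side is zero. -/
theorem riemLow_antisymm_right (i j k l : ι) :
    riemLow d g Γ i j l k = -riemLow d g Γ i j k l := by
  have h1 := CovDeriv.commutator_two (Γ := Γ) h.comm (fun j k => g j k) i j k l
  simp only [h.metric_parallel, map_zero, Pi.zero_apply, sub_zero] at h1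
  have h2 : ∑ m, curv Γ d i j k m * g m l = riemLow d g Γ i j k l :=
    Finset.sum_congr rfl fun m _ => by rw [mul_comm, h.metric_symm m l]
  have h3 : ∑ m, curv Γ d i j l m * g k m = riemLow d g Γ i j l k :=
    Finset.sum_congr rfl fun m _ => by rw [mul_comm]
  rw [h2, h3] at h1
  linear_combination h1

/-- The classical octahedron argument: four instances of the first Bianchi identity, obtained by
cycling the indices, combine through the two antisymmetries to twice the claim. -/
theorem riemLow_pair_symm (i j k l : ι) : riemLow d g Γ k l i j = riemLow d g Γ i j k l := by
  refine sub_eq_zero.mp (eq_zero_of_two_mul ?_)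
  have a := h.riemLow_antisymm_left
  have b := h.riemLow_antisymm_right
  have c := h.riemLow_bianchi
  have e1 := c i j k l
  have e2 := c j k l i
  have e3 := c k l i j
  have e4 := c l i j k
  rw [b j k i l, b k l i j, a j l k i, b j l i k] at e2
  rw [b l i j k, a i l j k, a k i l j, b k i j l] at e3
  rw [a i l j k, b i j k l] at e4
  linear_combination e3 + e4 - e1 - e2

theorem sharp_riemLow (i j k : ι) : applyMatrix gi (riemLow d g Γ i j k) = curv Γ d i j k :=
  h.sharp_flat _

theorem ricci_eq_metricTrace (j k : ι) :
    ricci d Γ j k = metricTrace gi fun p q => riemLow d g Γ p j k q := by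
  rw [metricTrace_eq_contract]
  exact Finset.sum_congr rfl fun p _ => (congrFun (h.sharp_riemLow p j k) p).symm

theorem ricci_symm (j k : ι) : ricci d Γ j k = ricci d Γ k j := by
  rw [h.ricci_eq_metricTrace, h.ricci_eq_metricTrace, ← h.metricTrace_swap]
  congr 1
  funext p q
  rw [← h.riemLow_pair_symm, h.riemLow_antisymm_left, h.riemLow_antisymm_right, neg_neg]

theorem dRicci_symm (i j k : ι) : dRicci d Γ i j k = dRicci d Γ i k j := by
  have hR : ricci d Γ = fun j k => ricci d Γ k j := funext fun j => funext fun k => h.ricci_symm j k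
  calc dRicci d Γ i j k = (CovDeriv.lower2 d Γ).D i (fun j k => ricci d Γ k j) j k := by
        rw [dRicci, ← hR]
    _ = _ := by
      simp only [dRicci, CovDeriv.lower2_apply]
      ring

theorem dRiemLow_antisymm_left (p i j k l : ι) :
    dRiemLow d g Γ p j i k l = -dRiemLow d g Γ p i j k l := by
  simp only [dRiemLow, CovDeriv.lower4_apply, h.riemLow_antisymm_left i j,
    h.riemLow_antisymm_left _ j, h.riemLow_antisymm_left i _, map_neg, mul_neg,
    Finset.sum_neg_distrib]
  ring

theorem dRiemLow_antisymm_right (p i j k l : ι) :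
    dRiemLow d g Γ p i j l k = -dRiemLow d g Γ p i j k l := by
  simp only [dRiemLow, CovDeriv.lower4_apply, h.riemLow_antisymm_right _ _ k l,
    h.riemLow_antisymm_right _ _ k _, h.riemLow_antisymm_right _ _ _ l, map_neg, mul_neg,
    Finset.sum_neg_distrib]
  ring

/-- Lowering the last index commutes with ∇; `lower_map` carries this past the three outer indices.
It transfers the second Bianchi identity to the fully lowered tensor. -/
theorem dRiemLow_eq (p i j k : ι) :
    dRiemLow d g Γ p i j k = applyMatrix g
      ((((((CovDeriv.base d).upper Γ).lower Γ).lower Γ).lower Γ).D p (curv Γ d) i j k) := by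
  have h1 := CovDeriv.lower_map (Γ := Γ) ((CovDeriv.base d).upper Γ) ((CovDeriv.base d).lower Γ)
    (applyMatrix g) (h.flat_parallel _)
  let f1 : (ι → ι → A) →ₗ[A] (ι → ι → A) := (applyMatrix g).compLeft ι
  have h2 := CovDeriv.lower_map (Γ := Γ) (((CovDeriv.base d).upper Γ).lower Γ)
    (((CovDeriv.base d).lower Γ).lower Γ) f1 h1
  let f2 : (ι → ι → ι → A) →ₗ[A] (ι → ι → ι → A) := f1.compLeft ι
  have h3 := CovDeriv.lower_map (Γ := Γ) ((((CovDeriv.base d).upper Γ).lower Γ).lower Γ)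
    ((((CovDeriv.base d).lower Γ).lower Γ).lower Γ) f2 h2
  exact congrFun (congrFun (congrFun (h3 p (curv Γ d)) i) j) k

theorem dRiemLow_bianchi (p i j k l : ι) :
    dRiemLow d g Γ p i j k l + dRiemLow d g Γ i j p k l + dRiemLow d g Γ j p i k l = 0 := by
  have e (m : ι) := curv_second_bianchi h.comm h.symm p i j k m
  simp only [dRiemLow_eq h, applyMatrix_apply, ← Finset.sum_add_distrib, ← smul_add]
  exact Finset.sum_eq_zero fun m _ => by rw [e m, smul_zero]

theorem dRicci_eq_metricTrace (i j k : ι) :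
    dRicci d Γ i j k = metricTrace gi fun p q => dRiemLow d g Γ i p j k q := by
  -- `metricTrace` acts on the innermost pair, so the indices to be traced are moved there.
  let T : ι → ι → ι → ι → A := fun j k p q => riemLow d g Γ p j k q
  have hR : ricci d Γ = fun j k => metricTrace gi (T j k) := by
    funext j k
    exact h.ricci_eq_metricTrace j k
  have h1 := CovDeriv.lower_map (Γ := Γ) (CovDeriv.lower2 d Γ) (CovDeriv.base d)
    (metricTrace gi) (h.metricTrace_parallel _)
  have h2 := CovDeriv.lower_map (Γ := Γ) (CovDeriv.lower3 d Γ) ((CovDeriv.base d).lower Γ)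
    ((metricTrace gi).compLeft ι) h1
  have h3 := congrFun (congrFun (h2 i T) j) k
  have h4 : dRicci d Γ i j k = metricTrace gi ((CovDeriv.lower4 d Γ).D i T j k) := by
    unfold dRicci
    rw [hR]
    exact h3
  rw [h4]
  congr 1
  funext p q
  simp only [dRiemLow, CovDeriv.lower4_apply, T]
  ring

theorem deriv_scalarCurv (i : ι) :
    d i (scalarCurv d gi Γ) = metricTrace gi (dRicci d Γ i) :=
  h.metricTrace_parallel (CovDeriv.base d) i (ricci d Γ)

/-- The contracted second Bianchi identity. -/
theorem two_mul_div_ricci (j : ι) :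
    2 * metricTrace gi (fun p k => dRicci d Γ p j k) = d j (scalarCurv d gi Γ) := by
  -- The second Bianchi identity traced over its third-last pair partner: contraction with g^{il}
  -- turns two of the three terms into derivatives of Ricci.
  have h1 (a k : ι) : dRicci d Γ a j k
      + metricTrace gi (fun i l => dRiemLow d g Γ i j a k l) - dRicci d Γ j a k = 0 := by
    rw [h.dRicci_eq_metricTrace a, h.dRicci_eq_metricTrace j, ← map_add, ← map_sub]
    refine (congrArg (metricTrace gi) ?_).trans (map_zero (metricTrace (W := A) gi))
    funext i l
    simp only [Pi.add_apply, Pi.sub_apply, Pi.zero_apply]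
    linear_combination h.dRiemLow_bianchi a i j k l - h.dRiemLow_antisymm_left j i a k l
  -- Under the second trace the middle term becomes the divergence of Ricci once more, whence the
  -- factor 2.
  have h2 : metricTrace gi (fun a k => metricTrace gi (fun i l => dRiemLow d g Γ i j a k l))
      = metricTrace gi (fun i l => dRicci d Γ i j l) := by
    simp only [h.dRicci_eq_metricTrace]
    simp only [metricTrace_apply, smul_eq_mul, Finset.mul_sum]
    have e1 : ∀ F : ι → ι → ι → ι → A,
        ∑ a, ∑ k, ∑ i, ∑ l, F a k i l = ∑ i, ∑ l, ∑ a, ∑ k, F a k i l := by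
      intro F
      calc _ = ∑ a, ∑ i, ∑ k, ∑ l, F a k i l :=
            Finset.sum_congr rfl fun a _ => Finset.sum_comm
        _ = ∑ i, ∑ a, ∑ k, ∑ l, F a k i l := Finset.sum_comm
        _ = ∑ i, ∑ a, ∑ l, ∑ k, F a k i l :=
            Finset.sum_congr rfl fun i _ => Finset.sum_congr rfl fun a _ => Finset.sum_comm
        _ = _ := Finset.sum_congr rfl fun i _ => Finset.sum_comm
    rw [e1]
    refine Finset.sum_congr rfl fun i _ => Finset.sum_congr rfl fun l _ =>
      Finset.sum_congr rfl fun a _ => Finset.sum_congr rfl fun k _ => ?_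
    rw [h.dRiemLow_antisymm_left i a j k l, h.dRiemLow_antisymm_right i a j l k]
    ring
  have h3 : metricTrace gi (fun a k => dRicci d Γ a j k
      + metricTrace gi (fun i l => dRiemLow d g Γ i j a k l) - dRicci d Γ j a k) = 0 := by
    simp only [h1]
    exact map_zero _
  have h4 : metricTrace gi (fun a k => dRicci d Γ a j k)
      + metricTrace gi (fun a k => metricTrace gi (fun i l => dRiemLow d g Γ i j a k l))
      - metricTrace gi (dRicci d Γ j) = 0 := by
    rw [← map_add, ← map_sub]
    exact h3
  rw [h2, ← h.deriv_scalarCurv] at h4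
  linear_combination h4

end IsLeviCivita

end RicciCurvature

/-! ### Commuting derivatives of Ricci and the evolution equations -/

section Evolution

variable {ι A W : Type*} [Fintype ι] [DecidableEq ι] [CommRing A] [Algebra ℝ A]
  [AddCommGroup W] [Module A W]
  {d : ι → Derivation ℝ A A} {g gi : Matrix ι ι A} {Γ : ι → ι → ι → A}

/-- The second covariant derivative `∇_p ∇_q R_{ij}`. -/
abbrev ddRicci (d : ι → Derivation ℝ A A) (Γ : ι → ι → ι → A) (p q i j : ι) : A :=
  (CovDeriv.lower3 d Γ).D p (dRicci d Γ) q i j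

/-- The Hessian `∇_i ∇_j R` of the scalar curvature. -/
def hessScalar (d : ι → Derivation ℝ A A) (gi : Matrix ι ι A) (Γ : ι → ι → ι → A) (i j : ι) : A :=
  ((CovDeriv.base d).lower Γ).D i (fun j => d j (scalarCurv d gi Γ)) j

/-- The variation `-∇_i R_{jm} - ∇_j R_{im} + ∇_m R_{ij}` of the connection under the Ricci flow,
with its upper index lowered. -/
def flowTensor (d : ι → Derivation ℝ A A) (Γ : ι → ι → ι → A) (i j m : ι) : A :=
  -(dRicci d Γ i j m + dRicci d Γ j i m - dRicci d Γ m i j)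

/-- The curvature term `R_{pjk}^q R_q^p`. -/
def curvRicci (d : ι → Derivation ℝ A A) (gi : Matrix ι ι A) (Γ : ι → ι → ι → A) (j k : ι) : A :=
  ∑ p, ∑ q, curv Γ d p j k q * ricciUp d gi Γ q p

theorem derivation_two (D : Derivation ℝ A A) : D (2 : A) = 0 := by
  rw [← map_ofNat (algebraMap ℝ A) 2]
  exact D.map_algebraMap 2

namespace IsLeviCivita

variable (h : IsLeviCivita d g gi Γ)
include h

theorem hessScalar_symm (i j : ι) : hessScalar d gi Γ i j = hessScalar d gi Γ j i := by
  have h1 := CovDeriv.second_sub (CovDeriv.base d) h.symm i j (scalarCurv d gi Γ)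
  rw [CovDeriv.base_commutator h.comm, neg_zero] at h1
  exact sub_eq_zero.mp h1

/-- `∇_i R_j^l = g^{lm} ∇_i R_{jm}`. -/
theorem cov_ricciUp (i j : ι) :
    (((CovDeriv.base d).upper Γ).lower Γ).D i (ricciUp d gi Γ) j
      = applyMatrix gi (dRicci d Γ i j) :=
  congrFun (CovDeriv.lower_map (Γ := Γ) ((CovDeriv.base d).lower Γ) ((CovDeriv.base d).upper Γ)
    (applyMatrix gi) (h.sharp_parallel _) i (ricci d Γ)) j

/-- `∇_p ∇_q R_i^l = g^{lm} ∇_p ∇_q R_{im}`. -/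
theorem cov_cov_ricciUp (p q i : ι) :
    ((((CovDeriv.base d).upper Γ).lower Γ).lower Γ).D p
      (fun q => (((CovDeriv.base d).upper Γ).lower Γ).D q (ricciUp d gi Γ)) q i
      = applyMatrix gi (ddRicci d Γ p q i) := by
  have h1 := CovDeriv.lower_map (Γ := Γ) ((CovDeriv.base d).lower Γ) ((CovDeriv.base d).upper Γ)
    (applyMatrix gi) (h.sharp_parallel _)
  have h2 := CovDeriv.lower_map (Γ := Γ) (CovDeriv.lower2 d Γ)
    (((CovDeriv.base d).upper Γ).lower Γ) ((applyMatrix gi).compLeft ι) h1 p (dRicci d Γ)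
  have h3 : (fun q => (((CovDeriv.base d).upper Γ).lower Γ).D q (ricciUp d gi Γ))
      = fun q => ((applyMatrix gi).compLeft ι) (dRicci d Γ q) := by
    funext q j
    exact h.cov_ricciUp q j
  rw [h3, h2]
  rfl

theorem ddRicci_symm (p q i j : ι) : ddRicci d Γ p q i j = ddRicci d Γ p q j i := by
  have hR : dRicci d Γ = fun q i j => dRicci d Γ q j i :=
    funext fun q => funext fun i => funext fun j => h.dRicci_symm q i j
  calc ddRicci d Γ p q i j = (CovDeriv.lower3 d Γ).D p (fun q i j => dRicci d Γ q j i) q i j := by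
        rw [ddRicci, ← hR]
    _ = _ := by
      simp only [ddRicci, CovDeriv.lower3_apply]
      ring

/-- Contracting the first index with the third, rather than with the fourth, costs a sign by
antisymmetry in the last pair. -/
theorem metricTrace_curv (j q : ι) :
    metricTrace gi (fun p m => curv Γ d p j m q) = -ricciUp d gi Γ j q := by
  have h1 (p m : ι) : curv Γ d p j m q = -∑ r, gi q r * riemLow d g Γ p j r m := by
    rw [← h.sharp_riemLow, applyMatrix_apply, ← Finset.sum_neg_distrib]
    exact Finset.sum_congr rfl fun r _ => by
      rw [h.riemLow_antisymm_right p j r m, smul_eq_mul, mul_neg]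
  simp only [h1, ricciUp, h.ricci_eq_metricTrace, metricTrace_apply, smul_eq_mul, mul_neg,
    Finset.sum_neg_distrib, Finset.mul_sum]
  congr 1
  rw [Finset.sum_comm_cycle]
  refine Finset.sum_congr rfl fun r _ => Finset.sum_congr rfl fun p _ =>
    Finset.sum_congr rfl fun m _ => by ring

/-- Pair symmetry of the curvature, contracted with the symmetric tensor `V`, which is Ricci with
both indices raised. -/
theorem curvRicci_symm (j k : ι) : curvRicci d gi Γ j k = curvRicci d gi Γ k j := by
  let V : ι → ι → A := fun r p => ∑ q, gi q r * ricciUp d gi Γ q p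
  have hV (r p : ι) : V r p = V p r := by
    simp only [V, ricciUp, Finset.mul_sum]
    rw [Finset.sum_comm]
    refine Finset.sum_congr rfl fun s _ => Finset.sum_congr rfl fun q _ => ?_
    rw [h.inv_symm p s, h.inv_symm q r, h.ricci_symm q s]
    ring
  have h1 (j k : ι) : curvRicci d gi Γ j k = ∑ p, ∑ r, riemLow d g Γ p j k r * V r p := by
    refine Finset.sum_congr rfl fun p _ => ?_
    simp only [← h.sharp_riemLow, applyMatrix_apply, smul_eq_mul, Finset.sum_mul, V,
      Finset.mul_sum]
    rw [Finset.sum_comm]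
    exact Finset.sum_congr rfl fun r _ => Finset.sum_congr rfl fun q _ => by ring
  rw [h1, h1, Finset.sum_comm]
  refine Finset.sum_congr rfl fun p _ => Finset.sum_congr rfl fun r _ => ?_
  rw [hV, ← h.riemLow_pair_symm, h.riemLow_antisymm_left, h.riemLow_antisymm_right, neg_neg]

/-- The Ricci identity exchanges ∇_p and ∇_j. In the exchanged order the trace is ∇_j of the
divergence of Ricci, hence half the Hessian of R, and the curvature terms contract to the two
quadratic terms. -/
theorem metricTrace_ddRicci (j k : ι) :
    2 * metricTrace gi (fun p m => ddRicci d Γ p j k m)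
      = hessScalar d gi Γ j k + 2 * ∑ q, ricciUp d gi Γ j q * ricci d Γ k q
        - 2 * curvRicci d gi Γ j k := by
  have h1 (p m : ι) : ddRicci d Γ p j k m = ddRicci d Γ j p k m
      - (∑ q, curv Γ d p j m q * ricci d Γ k q + ∑ q, curv Γ d p j k q * ricci d Γ q m) := by
    have e1 := congrFun (congrFun
      (CovDeriv.second_sub (CovDeriv.lower2 d Γ) h.symm p j (ricci d Γ)) k) m
    have e2 := CovDeriv.commutator_two (Γ := Γ) h.comm (ricci d Γ) p j k m
    simp only [Pi.sub_apply] at e1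
    rw [e2] at e1
    linear_combination e1
  have h2 : 2 * metricTrace gi (fun p m => ddRicci d Γ j p k m) = hessScalar d gi Γ j k := by
    have e1 := CovDeriv.lower_map (Γ := Γ) (CovDeriv.lower2 d Γ) (CovDeriv.base d)
      (metricTrace gi) (h.metricTrace_parallel _) j (fun k p m => dRicci d Γ p k m)
    have e2 : (fun k => d k (scalarCurv d gi Γ))
        = (2 : A) • fun k => metricTrace gi (fun p m => dRicci d Γ p k m) := by
      funext k
      exact (h.two_mul_div_ricci k).symm
    rw [hessScalar, e2, CovDeriv.leibniz, derivation_two, zero_smul, zero_add, e1, Pi.smul_apply, smul_eq_mul]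
    congr 2
    funext p m
    simp only [ddRicci, CovDeriv.lower3_apply]
    ring
  have h3 : metricTrace gi (fun p m => ∑ q, curv Γ d p j m q * ricci d Γ k q)
      = -∑ q, ricciUp d gi Γ j q * ricci d Γ k q := by
    simp only [← neg_mul, ← Finset.sum_neg_distrib, ← h.metricTrace_curv]
    simp only [metricTrace_apply, smul_eq_mul, Finset.sum_mul, Finset.mul_sum]
    rw [Finset.sum_comm_cycle]
    simp only [mul_assoc]
  have h4 : metricTrace gi (fun p m => ∑ q, curv Γ d p j k q * ricci d Γ q m)
      = curvRicci d gi Γ j k := by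
    simp only [metricTrace_apply, curvRicci, ricciUp, smul_eq_mul, Finset.mul_sum]
    refine Finset.sum_congr rfl fun p _ => ?_
    rw [Finset.sum_comm]
    exact Finset.sum_congr rfl fun q _ => Finset.sum_congr rfl fun m _ => by ring
  have h5 : metricTrace gi (fun p m => ddRicci d Γ p j k m)
      = metricTrace gi (fun p m => ddRicci d Γ j p k m)
        - (metricTrace gi (fun p m => ∑ q, curv Γ d p j m q * ricci d Γ k q)
          + metricTrace gi (fun p m => ∑ q, curv Γ d p j k q * ricci d Γ q m)) := by
    rw [← map_add, ← map_sub]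
    congr 1
    funext p m
    exact h1 p m
  rw [h3, h4] at h5
  linear_combination 2 * h5 + h2

variable {δ : Derivation ℝ A A} (hδ : ∀ i a, δ (d i a) = d i (δ a))
  (hflow : ∀ i j, δ (g i j) = -2 * ricci d Γ i j)
include hδ hflow

/-- The evolution of the Levi-Civita connection under the Ricci flow. -/
theorem flow_connection (i j : ι) :
    (fun l => δ (Γ i j l)) = applyMatrix gi (flowTensor d Γ i j) := by
  -- The time derivative of ∇g = 0, with ∂_t g = -2 Ric.
  have e (i j k : ι) : -2 * dRicci d Γ i j k
      = ∑ m, g k m * δ (Γ i j m) + ∑ m, g j m * δ (Γ i k m) := by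
    have h1 := congrArg δ (h.compat i j k)
    simp only [hδ, hflow, map_add, map_sum, Derivation.leibniz, smul_eq_mul, derivation_two, map_neg,
      Finset.sum_add_distrib] at h1
    simp only [dRicci, CovDeriv.lower2_apply]
    simp only [mul_sub, Finset.mul_sum]
    have e1 : ∀ m, Γ i j m * (-2 * ricci d Γ m k) = -2 * (Γ i j m * ricci d Γ m k) :=
      fun m => by ring
    have e2 : ∀ m, Γ i k m * (-2 * ricci d Γ j m) = -2 * (Γ i k m * ricci d Γ j m) :=
      fun m => by ring
    simp only [e1, e2, h.metric_symm _ k] at h1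
    linear_combination h1
  -- Two permutations of `e` minus the third isolate twice the lowered ∂_t Γ, as in the Koszul
  -- formula.
  have hlow : applyMatrix g (fun l => δ (Γ i j l)) = flowTensor d Γ i j := by
    funext k
    refine sub_eq_zero.mp (eq_zero_of_two_mul ?_)
    simp only [applyMatrix_apply, flowTensor, smul_eq_mul]
    have e1 := e i j k
    have e2 := e j i k
    have e3 := e k i j
    simp only [h.symm j i, h.symm k i, h.symm k j] at e1 e2 e3
    linear_combination -e1 - e2 + e3
  rw [← hlow, h.sharp_flat]

/-- The evolution of the Ricci tensor under the Ricci flow. -/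
theorem flow_ricci (j k : ι) :
    δ (ricci d Γ j k) = metricTrace gi (fun p q => ddRicci d Γ p q j k)
      + 2 * curvRicci d gi Γ j k - 2 * ∑ q, ricciUp d gi Γ j q * ricci d Γ k q := by
  have hC : (fun i j k => δ (Γ i j k)) = fun i j => applyMatrix gi (flowTensor d Γ i j) :=
    funext fun i => funext fun j => h.flow_connection hδ hflow i j
  have h1 (p j k l : ι) : ((((CovDeriv.base d).upper Γ).lower Γ).lower Γ).D p
      (fun i j k => δ (Γ i j k)) j k l
      = applyMatrix gi ((CovDeriv.lower3 d Γ).D p (flowTensor d Γ) j k) l := by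
    have e1 := CovDeriv.lower_map (Γ := Γ) ((CovDeriv.base d).lower Γ) ((CovDeriv.base d).upper Γ)
      (applyMatrix gi) (h.sharp_parallel _)
    have e2 := CovDeriv.lower_map (Γ := Γ) (CovDeriv.lower2 d Γ)
      (((CovDeriv.base d).upper Γ).lower Γ) ((applyMatrix gi).compLeft ι) e1 p (flowTensor d Γ)
    rw [hC]
    exact congrFun (congrFun (congrFun e2 j) k) l
  have h2 (p j k m : ι) : (CovDeriv.lower3 d Γ).D p (flowTensor d Γ) j k m
      = -(ddRicci d Γ p j k m + ddRicci d Γ p k j m - ddRicci d Γ p m j k) := by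
    simp only [ddRicci, CovDeriv.lower3_apply, flowTensor, map_neg, map_add, map_sub, mul_neg,
      mul_add, mul_sub, Finset.sum_neg_distrib, Finset.sum_add_distrib, Finset.sum_sub_distrib]
    ring
  -- The variation of the curvature, traced over its first and last index.
  have h3 : δ (ricci d Γ j k)
      = metricTrace gi (fun p m => (CovDeriv.lower3 d Γ).D p (flowTensor d Γ) j k m)
        - metricTrace gi (fun p m => (CovDeriv.lower3 d Γ).D j (flowTensor d Γ) p k m) := by
    rw [metricTrace_eq_contract, metricTrace_eq_contract, ricci, map_sum]
    simp only [contract, LinearMap.coe_mk, AddHom.coe_mk, ← Finset.sum_sub_distrib]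
    refine Finset.sum_congr rfl fun p _ => ?_
    rw [curv_variation δ hδ h.symm, h1, h1]
  have h4 : metricTrace gi (fun p m => (CovDeriv.lower3 d Γ).D p (flowTensor d Γ) j k m)
      = -(metricTrace gi (fun p m => ddRicci d Γ p j k m)
        + metricTrace gi (fun p m => ddRicci d Γ p k j m)
        - metricTrace gi (fun p m => ddRicci d Γ p m j k)) := by
    rw [← map_add, ← map_sub, ← map_neg]
    congr 1
    funext p m
    exact h2 p j k m
  have h5 : metricTrace gi (fun p m => (CovDeriv.lower3 d Γ).D j (flowTensor d Γ) p k m)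
      = -(metricTrace gi (fun p m => ddRicci d Γ j p k m)
        + metricTrace gi (fun p m => ddRicci d Γ j k p m)
        - metricTrace gi (fun p m => ddRicci d Γ j m p k)) := by
    rw [← map_add, ← map_sub, ← map_neg]
    congr 1
    funext p m
    exact h2 j p k m
  -- By this equality two of the three traces in `h5` cancel, leaving only the Hessian of R.
  have h6 : metricTrace gi (fun p m => ddRicci d Γ j m p k)
      = metricTrace gi (fun p m => ddRicci d Γ j p k m) := by
    rw [← h.metricTrace_swap]
    congr 1
    funext p m
    exact h.ddRicci_symm j p m k
  have h7 : metricTrace gi (fun p m => ddRicci d Γ j k p m) = hessScalar d gi Γ j k := by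
    have e1 := congrFun (CovDeriv.lower_map (Γ := Γ) (CovDeriv.lower2 d Γ) (CovDeriv.base d)
      (metricTrace gi) (h.metricTrace_parallel _) j (dRicci d Γ)) k
    rw [hessScalar]
    simp only [h.deriv_scalarCurv]
    exact e1.symm
  have h8 : ∑ q, ricciUp d gi Γ k q * ricci d Γ j q = ∑ q, ricciUp d gi Γ j q * ricci d Γ k q := by
    simp only [ricciUp, Finset.sum_mul]
    rw [Finset.sum_comm]
    exact Finset.sum_congr rfl fun m _ => Finset.sum_congr rfl fun q _ => by
      rw [h.inv_symm q m]; ring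
  -- The two mixed traces in `h4` each contribute half a Hessian of R; together they cancel the
  -- Hessian from `h7`.
  have h9 := h.metricTrace_ddRicci j k
  have h10 := h.metricTrace_ddRicci k j
  rw [h8, h.curvRicci_symm k j, h.hessScalar_symm k j] at h10
  rw [h4, h5, h6, h7] at h3
  refine sub_eq_zero.mp (eq_zero_of_two_mul ?_)
  linear_combination 2 * h3 - h9 - h10

/-- The evolution of the Ricci operator under the Ricci flow. -/
theorem flow_ricciUp (i l : ι) :
    δ (ricciUp d gi Γ i l)
      = metricTrace gi (fun p q => ((((CovDeriv.base d).upper Γ).lower Γ).lower Γ).D p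
          (fun q => (((CovDeriv.base d).upper Γ).lower Γ).D q (ricciUp d gi Γ)) q i l)
        + 2 * ∑ m, ∑ p, ∑ q, gi l m * curv Γ d p i m q * ricciUp d gi Γ q p := by
  have h1 (m : ι) : δ (gi l m) = 2 * ∑ q, gi m q * ricciUp d gi Γ q l := by
    have e := congrFun (congrFun (h.derivation_inv δ) l) m
    simp only [Matrix.map_apply, Matrix.neg_apply, Matrix.mul_apply, hflow, Finset.sum_mul] at e
    simp only [e, ricciUp, Finset.mul_sum, ← Finset.sum_neg_distrib]
    refine Finset.sum_congr rfl fun q _ => Finset.sum_congr rfl fun r _ => ?_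
    rw [h.inv_symm q m, h.ricci_symm q r]
    ring
  have h2 : metricTrace gi (fun p q => ((((CovDeriv.base d).upper Γ).lower Γ).lower Γ).D p
      (fun q => (((CovDeriv.base d).upper Γ).lower Γ).D q (ricciUp d gi Γ)) q i l)
      = ∑ m, gi l m * metricTrace gi (fun p q => ddRicci d Γ p q i m) := by
    simp only [h.cov_cov_ricciUp, applyMatrix_apply, metricTrace_apply, smul_eq_mul,
      Finset.mul_sum]
    rw [Finset.sum_comm_cycle]
    exact Finset.sum_congr rfl fun m _ => Finset.sum_congr rfl fun p _ =>
      Finset.sum_congr rfl fun q _ => by ring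
  -- Raising the index adds 2 R_i^q R_q^l through ∂_t g⁻¹, which exactly cancels the quadratic Ricci
  -- term of `flow_ricci`.
  have h3 : ∑ m, ricci d Γ i m * δ (gi l m)
      = 2 * ∑ m, gi l m * ∑ q, ricciUp d gi Γ i q * ricci d Γ m q := by
    simp only [h1, ricciUp, Finset.mul_sum, Finset.sum_mul]
    rw [Finset.sum_comm_cycle]
    refine Finset.sum_congr rfl fun r _ => ?_
    rw [Finset.sum_comm]
    refine Finset.sum_congr rfl fun q _ => Finset.sum_congr rfl fun m _ => ?_
    rw [h.inv_symm m q, h.ricci_symm q r]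
    ring
  have h4 : ∑ m, ∑ p, ∑ q, gi l m * curv Γ d p i m q * ricciUp d gi Γ q p
      = ∑ m, gi l m * curvRicci d gi Γ i m := by
    simp only [curvRicci, Finset.mul_sum, mul_assoc]
  rw [h2, h4]
  conv_lhs => rw [ricciUp, map_sum]
  simp only [Derivation.leibniz, smul_eq_mul, h.flow_ricci hδ hflow, Finset.sum_add_distrib, h3]
  simp only [mul_add, mul_sub, Finset.sum_add_distrib, Finset.sum_sub_distrib, Finset.mul_sum]
  have e : ∀ a b : A, a * (2 * b) = 2 * (a * b) := fun a b => by ring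
  simp only [e]
  ring

/-- The evolution of the connection under the Ricci flow, in mixed components. -/
theorem flow_connection_mixed (i k l : ι) :
    δ (Γ i k l) = -(((CovDeriv.base d).upper Γ).lower Γ).D i (ricciUp d gi Γ) k l
      - (((CovDeriv.base d).upper Γ).lower Γ).D k (ricciUp d gi Γ) i l
      + ∑ m, gi l m * dRicci d Γ m i k := by
  have e := congrFun (h.flow_connection hδ hflow i k) l
  simp only [h.cov_ricciUp]
  rw [e]
  simp only [applyMatrix_apply, flowTensor, smul_eq_mul, mul_neg, mul_add, mul_sub,
    Finset.sum_add_distrib, Finset.sum_sub_distrib, Finset.sum_neg_distrib]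
  ring

end IsLeviCivita

end Evolution

/-! ### Smooth functions on a set with unique derivatives -/

section SmoothFunctions

variable {X : Type*} [NormedAddCommGroup X] [NormedSpace ℝ X] {S : Set X}

/-- The extension by zero of a function on `S`. -/
def extendZero (f : S → ℝ) : X → ℝ := Function.extend Subtype.val f 0

theorem extendZero_apply (f : S → ℝ) (x : S) : extendZero f x = f x :=
  Subtype.val_injective.extend_apply f 0 x

theorem extendZero_eqOn {f : S → ℝ} {F : X → ℝ} (h : ∀ x : S, f x = F x) :
    Set.EqOn (extendZero f) F S := fun x hx => (extendZero_apply f ⟨x, hx⟩).trans (h ⟨x, hx⟩)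

/-- The algebra of smooth functions on `S`. -/
def smoothFun (S : Set X) : Subalgebra ℝ (S → ℝ) where
  carrier := {f | ContDiffOn ℝ ∞ (extendZero f) S}
  mul_mem' {a b} ha hb := (ContDiffOn.mul ha hb).congr <| extendZero_eqOn fun x => by
    simp [extendZero_apply]
  add_mem' {a b} ha hb := (ContDiffOn.add ha hb).congr <| extendZero_eqOn fun x => by
    simp [extendZero_apply]
  algebraMap_mem' r := (contDiffOn_const (c := r)).congr <| extendZero_eqOn fun x => rfl

/-- The restriction to `S` of a function that is smooth on `S`. -/
def smoothRestrict (F : X → ℝ) (hF : ContDiffOn ℝ ∞ F S) : smoothFun S :=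
  ⟨fun x => F x, hF.congr <| extendZero_eqOn fun _ => rfl⟩

theorem smoothRestrict_apply (F : X → ℝ) (hF : ContDiffOn ℝ ∞ F S) (x : S) :
    (smoothRestrict F hF).1 x = F x := rfl

/-- Evaluation at a point. -/
def evalAt (x : S) : smoothFun S →+* ℝ :=
  (Pi.evalRingHom (fun _ : S => ℝ) x).comp (smoothFun S).val.toRingHom

theorem evalAt_apply (x : S) (a : smoothFun S) : evalAt x a = a.1 x := rfl

theorem smoothFun_ext {a b : smoothFun S} (h : ∀ x, evalAt x a = evalAt x b) : a = b :=
  Subtype.ext (funext h)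

theorem smoothFun_hasFDerivWithinAt (a : smoothFun S) (x : S) :
    HasFDerivWithinAt (extendZero a.1) (fderivWithin ℝ (extendZero a.1) S x) S x :=
  (ContDiffOn.differentiableOn a.2 (by simp) x x.2).hasFDerivWithinAt

/-- The directional derivative, as a derivation on smooth functions on `S`. -/
def dirDeriv (hS : UniqueDiffOn ℝ S) (v : X) : Derivation ℝ (smoothFun S) (smoothFun S) :=
  Derivation.mk'
    { toFun := fun a => smoothRestrict (fun x => fderivWithin ℝ (extendZero a.1) S x v)
        ((ContDiffOn.fderivWithin a.2 hS (by simp)).clm_apply contDiffOn_const)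
      map_add' := fun a b => smoothFun_ext fun x => by
        have h := ((smoothFun_hasFDerivWithinAt a x).add (smoothFun_hasFDerivWithinAt b x)).congr
          (f₁ := extendZero (a + b).1) (extendZero_eqOn fun x => by simp [extendZero_apply])
          (by simp [extendZero_apply])
        simp only [map_add, evalAt_apply, smoothRestrict_apply, h.fderivWithin (hS x x.2)]
        rfl
      map_smul' := fun r a => smoothFun_ext fun x => by
        have h := ((smoothFun_hasFDerivWithinAt a x).const_smul r).congr
          (f₁ := extendZero (r • a).1) (extendZero_eqOn fun x => by simp [extendZero_apply])
          (by simp [extendZero_apply])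
        simp only [evalAt_apply, smoothRestrict_apply, h.fderivWithin (hS x x.2)]
        rfl }
    fun a b => smoothFun_ext fun x => by
      have h := ((smoothFun_hasFDerivWithinAt a x).mul (smoothFun_hasFDerivWithinAt b x)).congr
        (f₁ := extendZero (a * b).1) (extendZero_eqOn fun x => by simp [extendZero_apply])
        (by simp [extendZero_apply])
      simp only [smul_eq_mul, map_add, map_mul, LinearMap.coe_mk, AddHom.coe_mk, evalAt_apply,
        smoothRestrict_apply, h.fderivWithin (hS x x.2), add_apply,
        smul_apply, extendZero_apply]

theorem dirDeriv_apply (hS : UniqueDiffOn ℝ S) (v : X) (a : smoothFun S) (x : S) :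
    evalAt x (dirDeriv hS v a) = fderivWithin ℝ (extendZero a.1) S x v := rfl

/-- Symmetry of the second derivative within S. At boundary points, such as those with t = 0, it
depends on S lying in the closure of its interior. -/
theorem dirDeriv_comm (hS : UniqueDiffOn ℝ S) (hcl : S ⊆ closure (interior S)) (v w : X)
    (a : smoothFun S) :
    dirDeriv hS v (dirDeriv hS w a) = dirDeriv hS w (dirDeriv hS v a) := by
  have key (v w : X) (x : S) : evalAt x (dirDeriv hS v (dirDeriv hS w a))
      = fderivWithin ℝ (fderivWithin ℝ (extendZero a.1) S) S x v w := by
    have hd : DifferentiableWithinAt ℝ (fderivWithin ℝ (extendZero a.1) S) S x :=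
      (ContDiffOn.fderivWithin (m := ∞) a.2 hS (by simp)).differentiableOn (by simp) x x.2
    have h := (hd.hasFDerivWithinAt.clm_apply (hasFDerivWithinAt_const w (x : X) S)).congr
      (f₁ := extendZero (dirDeriv hS w a).1) (extendZero_eqOn fun x => rfl)
      (extendZero_apply _ x)
    rw [dirDeriv_apply, h.fderivWithin (hS x x.2)]
    simp
  refine smoothFun_ext fun x => ?_
  rw [key, key]
  exact ContDiffWithinAt.isSymmSndFDerivWithinAt (contDiffOn_infty.mp a.2 2 x x.2) (by simp) hS
    (hcl x.2) x.2 v w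

end SmoothFunctions

/-! ### Smooth functions on a product of space and time -/

section Product

variable {n : ℕ} {U : Set (EuclideanSpace ℝ (Fin n))} {J : Set ℝ}

/-- The spatial partial derivative on functions of space and time. -/
def spaceDeriv (hS : UniqueDiffOn ℝ (U ×ˢ J)) (i : Fin n) :
    Derivation ℝ (smoothFun (U ×ˢ J)) (smoothFun (U ×ˢ J)) :=
  dirDeriv hS (EuclideanSpace.single i 1, 0)

/-- The time derivative on functions of space and time. -/
def timeDeriv (hS : UniqueDiffOn ℝ (U ×ˢ J)) :
    Derivation ℝ (smoothFun (U ×ˢ J)) (smoothFun (U ×ˢ J)) :=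
  dirDeriv hS (0, 1)

/-- Chain rule along the slice z ↦ (z, t). As U is open, the derivative within U is the unrestricted
one used by `pd`, and φ matters only on U. -/
theorem pd_eq_spaceDeriv (hS : UniqueDiffOn ℝ (U ×ˢ J)) (hU : IsOpen U)
    (a : smoothFun (U ×ˢ J)) (φ : EuclideanSpace ℝ (Fin n) → ℝ) {t : ℝ} (ht : t ∈ J)
    (hφ : ∀ z (hz : z ∈ U), φ z = evalAt (S := U ×ˢ J) ⟨(z, t), hz, ht⟩ a) (i : Fin n)
    {y : EuclideanSpace ℝ (Fin n)} (hy : y ∈ U) :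
    pd i φ y = evalAt (S := U ×ˢ J) ⟨(y, t), hy, ht⟩ (spaceDeriv hS i a) := by
  have h1 := HasFDerivWithinAt.comp (f := fun z => (z, t)) y
    (smoothFun_hasFDerivWithinAt a ⟨(y, t), hy, ht⟩)
    ((hasFDerivWithinAt_id y U).prodMk (hasFDerivWithinAt_const t y U))
    (fun z (hz : z ∈ U) => Set.mk_mem_prod hz ht)
  have h2 := (h1.congr (f₁ := φ) (fun z hz => (hφ z hz).trans
    (extendZero_apply a.1 ⟨(z, t), hz, ht⟩).symm) ((hφ y hy).trans
    (extendZero_apply a.1 ⟨(y, t), hy, ht⟩).symm)).hasFDerivAt (hU.mem_nhds hy)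
  rw [pd, h2.fderiv]
  rfl

theorem hasDerivWithinAt_timeDeriv (hS : UniqueDiffOn ℝ (U ×ˢ J))
    (a : smoothFun (U ×ˢ J)) (φ : ℝ → ℝ) {y : EuclideanSpace ℝ (Fin n)} (hy : y ∈ U)
    (hφ : ∀ s (hs : s ∈ J), φ s = evalAt (S := U ×ˢ J) ⟨(y, s), hy, hs⟩ a) {t : ℝ} (ht : t ∈ J) :
    HasDerivWithinAt φ (evalAt (S := U ×ˢ J) ⟨(y, t), hy, ht⟩ (timeDeriv hS a)) J t := by
  have h1 := HasFDerivWithinAt.comp (f := fun s => (y, s)) t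
    (smoothFun_hasFDerivWithinAt a ⟨(y, t), hy, ht⟩)
    ((hasFDerivWithinAt_const y t J).prodMk (hasFDerivWithinAt_id t J))
    (fun z (hz : z ∈ J) => Set.mk_mem_prod hy hz)
  have h2 := h1.congr (f₁ := φ) (fun z hz => (hφ z hz).trans
    (extendZero_apply a.1 ⟨(y, z), hy, hz⟩).symm) ((hφ t ht).trans
    (extendZero_apply a.1 ⟨(y, t), hy, ht⟩).symm)
  exact h2.hasDerivWithinAt

end Product

/-! ### Time intervals -/

theorem timeInterval_ordConnected (T : EReal) : (timeInterval T).OrdConnected :=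
  ⟨fun _ hx _ hy _ hz => ⟨hx.1.trans hz.1, (EReal.coe_le_coe_iff.mpr hz.2).trans_lt hy.2⟩⟩

theorem timeInterval_interior_nonempty {T : EReal} {t : ℝ} (ht : t ∈ timeInterval T) :
    (interior (timeInterval T)).Nonempty := by
  obtain ⟨b, hb1, hb2⟩ := EReal.lt_iff_exists_real_btwn.mp ht.2
  have htb : t < b := EReal.coe_lt_coe_iff.mp hb1
  have hsub : Set.Ioo t b ⊆ timeInterval T := fun s hs =>
    ⟨ht.1.trans hs.1.le, (EReal.coe_lt_coe_iff.mpr hs.2).trans hb2⟩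
  exact (Set.nonempty_Ioo.mpr htb).mono (interior_maximal hsub isOpen_Ioo)

theorem timeInterval_uniqueDiffOn (T : EReal) : UniqueDiffOn ℝ (timeInterval T) := fun _ ht =>
  uniqueDiffOn_convex (timeInterval_ordConnected T).convex (timeInterval_interior_nonempty ht) _ ht

theorem timeInterval_subset_closure (T : EReal) :
    timeInterval T ⊆ closure (interior (timeInterval T)) := fun t ht => by
  have hc : Convex ℝ (timeInterval T) := (timeInterval_ordConnected T).convex
  rw [hc.closure_interior_eq_closure_of_nonempty_interior
    (timeInterval_interior_nonempty ht)]
  exact subset_closure ht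

theorem add_mem_timeInterval {T : EReal} {τ t : ℝ} (hτ : 0 ≤ τ)
    (ht : t ∈ timeInterval (T - (τ : EReal))) : t + τ ∈ timeInterval T := by
  refine ⟨add_nonneg ht.1 hτ, ?_⟩
  rw [EReal.coe_add]
  exact (EReal.lt_sub_iff_add_lt (Or.inl (EReal.coe_ne_bot τ)) (Or.inl (EReal.coe_ne_top τ))).mp ht.2

/-! ### The metric in a chart -/

section Chart

variable {n : ℕ} {M : Type*} [TopologicalSpace M] [ChartedSpace (EuclideanSpace ℝ (Fin n)) M]
  [IsManifold (𝓡 n) ∞ M]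

theorem metricCoeff_symm (e : OpenPartialHomeomorph M (EuclideanSpace ℝ (Fin n)))
    (g : SmoothMetric n M) (y : EuclideanSpace ℝ (Fin n)) (i j : Fin n) :
    metricCoeff e g y i j = metricCoeff e g y j i :=
  g.symm _ _ _

/-- A kernel vector c of the Gram matrix would give w = ∑ c_i e_i ≠ 0 whose image under the
injective differential of the inverse chart has length zero, against positivity of g. -/
theorem metricCoeff_det_ne_zero {e : OpenPartialHomeomorph M (EuclideanSpace ℝ (Fin n))}
    (he : e ∈ IsManifold.maximalAtlas (𝓡 n) ∞ M) (g : SmoothMetric n M)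
    {y : EuclideanSpace ℝ (Fin n)} (hy : y ∈ e.target) : (metricCoeff e g y).det ≠ 0 := by
  intro hdet
  obtain ⟨c, hc, hc0⟩ := Matrix.exists_mulVec_eq_zero_iff.mpr hdet
  have hdiff : e.MDifferentiable (𝓡 n) (𝓡 n) :=
    ⟨(contMDiffOn_of_mem_maximalAtlas he).mdifferentiableOn (by simp),
      (contMDiffOn_symm_of_mem_maximalAtlas he).mdifferentiableOn (by simp)⟩
  let L : EuclideanSpace ℝ (Fin n) →L[ℝ] TangentSpace (𝓡 n) (e.symm y) :=
    mfderiv (𝓡 n) (𝓡 n) e.symm y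
  have hinj : Function.Injective L := hdiff.symm.mfderiv_injective hy
  let w : EuclideanSpace ℝ (Fin n) := ∑ i, c i • EuclideanSpace.single i (1 : ℝ)
  have hw : w ≠ 0 := by
    intro h0
    refine hc (funext fun i => ?_)
    have := congrArg (fun v : EuclideanSpace ℝ (Fin n) => v i) h0
    simpa [w, Finset.sum_apply, Pi.single_apply] using this
  have hLw : L w ≠ 0 := fun h0 => hw (hinj (h0.trans (map_zero L).symm))
  have hpos := g.pos (e.symm y) (L w) hLw
  have hsum : g.inner (e.symm y) (L w) (L w)
      = ∑ i, c i * ∑ j, metricCoeff e g y i j * c j := by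
    have hL : L w = ∑ i, c i • coordVec e i y := by
      simp only [w, map_sum, map_smul]
      rfl
    rw [hL]
    simp only [map_sum, map_smul, sum_apply, smul_apply, smul_eq_mul, Finset.mul_sum]
    rw [Finset.sum_comm]
    refine Finset.sum_congr rfl fun i _ => Finset.sum_congr rfl fun j _ => ?_
    simp only [metricCoeff, Matrix.of_apply]
    ring
  have hzero (i : Fin n) : ∑ j, metricCoeff e g y i j * c j = 0 := congrFun hc0 i
  simp only [hsum, hzero, mul_zero, Finset.sum_const_zero, lt_self_iff_false] at hpos

end Chart

/-! ### The Levi-Civita connection from the Koszul formula -/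

section Koszul

variable {ι A : Type*} [Fintype ι] [DecidableEq ι] [CommRing A] [Algebra ℝ A]

/-- The Christoffel symbols of the metric `g` with inverse `gi`. -/
def koszul (d : ι → Derivation ℝ A A) (g gi : Matrix ι ι A) (i j k : ι) : A :=
  (1 / 2 : ℝ) • ∑ l, gi k l * (d i (g j l) + d j (g i l) - d l (g i j))

/-- Lowering the upper index undoes the inverse metric and leaves half the Koszul sum; adding the
two sums with j and k exchanged leaves ∂_i g_{jk}. -/
theorem isLeviCivita_koszul {d : ι → Derivation ℝ A A} {g gi : Matrix ι ι A}
    (hd : ∀ i j a, d i (d j a) = d j (d i a)) (hg : ∀ i j, g i j = g j i) (hgi : gi * g = 1) :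
    IsLeviCivita d g gi (koszul d g gi) where
  comm := hd
  symm i j k := by
    unfold koszul
    congr 1
    exact Finset.sum_congr rfl fun l _ => by rw [hg i j]; ring
  metric_symm := hg
  inv_mul := hgi
  compat i j k := by
    have hgg : g * gi = 1 := mul_eq_one_comm.mp hgi
    have h1 (i j k : ι) : ∑ m, g k m * koszul d g gi i j m
        = (1 / 2 : ℝ) • (d i (g j k) + d j (g i k) - d k (g i j)) := by
      simp only [koszul, mul_smul_comm, ← Finset.smul_sum]
      congr 1
      have h2 := congrFun (applyMatrix_mul g gi
        fun l => d i (g j l) + d j (g i l) - d l (g i j)) k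
      rw [hgg, applyMatrix_one] at h2
      exact h2
    have h3 (m : ι) : koszul d g gi i j m * g m k = g k m * koszul d g gi i j m := by
      rw [hg m k, mul_comm]
    simp only [h3, mul_comm _ (g j _), h1, ← smul_add]
    rw [hg k j]
    module

end Koszul

/-! ### From coordinate expressions to elements of the algebra -/

section Represents

variable {n : ℕ} {U : Set (EuclideanSpace ℝ (Fin n))} {J : Set ℝ}

/-- The time-dependent function `F` restricts to the smooth function `a` on `U × J`. -/
def Represents (a : smoothFun (U ×ˢ J)) (F : ℝ → EuclideanSpace ℝ (Fin n) → ℝ) : Prop :=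
  ∀ p : (U ×ˢ J : Set _), F p.1.2 p.1.1 = evalAt p a

namespace Represents

variable {a b : smoothFun (U ×ˢ J)} {F F' : ℝ → EuclideanSpace ℝ (Fin n) → ℝ}

theorem eq (h : Represents a F) {y : EuclideanSpace ℝ (Fin n)} {t : ℝ} (hy : y ∈ U) (ht : t ∈ J) :
    F t y = evalAt (S := U ×ˢ J) ⟨(y, t), hy, ht⟩ a :=
  h ⟨(y, t), hy, ht⟩

theorem add (h : Represents a F) (h' : Represents b F') :
    Represents (a + b) fun t y => F t y + F' t y := fun p => by rw [map_add, ← h p, ← h' p]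

theorem sub (h : Represents a F) (h' : Represents b F') :
    Represents (a - b) fun t y => F t y - F' t y := fun p => by rw [map_sub, ← h p, ← h' p]

theorem neg (h : Represents a F) : Represents (-a) fun t y => -F t y := fun p => by
  rw [map_neg, ← h p]

theorem mul (h : Represents a F) (h' : Represents b F') :
    Represents (a * b) fun t y => F t y * F' t y := fun p => by rw [map_mul, ← h p, ← h' p]

theorem smul (r : ℝ) (h : Represents a F) : Represents (r • a) fun t y => r * F t y := fun p => by
  exact congrArg (r * ·) (h p)

theorem sum {κ : Type*} [Fintype κ] {a : κ → smoothFun (U ×ˢ J)}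
    {F : κ → ℝ → EuclideanSpace ℝ (Fin n) → ℝ} (h : ∀ m, Represents (a m) (F m)) :
    Represents (∑ m, a m) fun t y => ∑ m, F m t y := fun p => by
  rw [map_sum]
  exact Finset.sum_congr rfl fun m _ => h m p

theorem pd (hS : UniqueDiffOn ℝ (U ×ˢ J)) (hU : IsOpen U) (h : Represents a F) (i : Fin n) :
    Represents (spaceDeriv hS i a) fun t y => RicciSpacetime.pd i (F t) y := fun p =>
  pd_eq_spaceDeriv hS hU a (F p.1.2) p.2.2 (fun _ hz => h.eq hz p.2.2) i p.2.1

theorem hasDerivWithinAt (hS : UniqueDiffOn ℝ (U ×ˢ J)) (h : Represents a F)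
    {y : EuclideanSpace ℝ (Fin n)} {t : ℝ} (hy : y ∈ U) (ht : t ∈ J) :
    HasDerivWithinAt (fun s => F s y)
      (evalAt (S := U ×ˢ J) ⟨(y, t), hy, ht⟩ (timeDeriv hS a)) J t :=
  hasDerivWithinAt_timeDeriv hS a (fun s => F s y) hy (fun _ hs => h.eq hy hs) ht

end Represents

/-- The inverse of a smooth matrix that is invertible at every point is smooth. -/
theorem exists_smooth_inverse {G : ℝ → EuclideanSpace ℝ (Fin n) → Matrix (Fin n) (Fin n) ℝ}
    {g : Matrix (Fin n) (Fin n) (smoothFun (U ×ˢ J))}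
    (hg : ∀ i j, Represents (g i j) fun t y => G t y i j)
    (hdet : ∀ t ∈ J, ∀ y ∈ U, (G t y).det ≠ 0) :
    ∃ gi : Matrix (Fin n) (Fin n) (smoothFun (U ×ˢ J)), gi * g = 1 ∧
      ∀ i j, Represents (gi i j) fun t y => (G t y)⁻¹ i j := by
  have hmap (p : (U ×ˢ J : Set _)) : (evalAt p).mapMatrix g = G p.1.2 p.1.1 := by
    ext i j
    exact (hg i j p).symm
  have hne (p : (U ×ˢ J : Set _)) : evalAt p g.det ≠ 0 := by
    rw [RingHom.map_det, hmap]
    exact hdet _ p.2.2 _ p.2.1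
  -- Cramer's rule: the inverse is the adjugate times the reciprocal `r` of the determinant, which
  -- is smooth because the determinant has no zero on U × J.
  let r : smoothFun (U ×ˢ J) := smoothRestrict (fun x => (extendZero g.det.1 x)⁻¹)
    (ContDiffOn.inv g.det.2 fun x hx => by
      rw [extendZero_apply g.det.1 ⟨x, hx⟩]
      exact hne ⟨x, hx⟩)
  have hr : r * g.det = 1 := smoothFun_ext fun p => by
    rw [map_mul, map_one, evalAt_apply, smoothRestrict_apply, extendZero_apply]
    exact inv_mul_cancel₀ (hne p)
  have hinv : (r • g.adjugate) * g = 1 := by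
    rw [Matrix.smul_mul, Matrix.adjugate_mul, smul_smul, hr, one_smul]
  refine ⟨r • g.adjugate, hinv, fun i j p => ?_⟩
  have h1 := congrArg (evalAt p).mapMatrix hinv
  rw [map_mul, map_one, hmap] at h1
  exact congrFun (congrFun (Matrix.inv_eq_left_inv h1) i) j

section Geometry

variable {G : ℝ → EuclideanSpace ℝ (Fin n) → Matrix (Fin n) (Fin n) ℝ}
  {g gi : Matrix (Fin n) (Fin n) (smoothFun (U ×ˢ J))}
  (hS : UniqueDiffOn ℝ (U ×ˢ J)) (hU : IsOpen U)
  (hg : ∀ i j, Represents (g i j) fun t y => G t y i j)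
  (hgi : ∀ i j, Represents (gi i j) fun t y => (G t y)⁻¹ i j)
include hU hg hgi

theorem represents_christoffel (i j k : Fin n) :
    Represents (koszul (spaceDeriv hS) g gi i j k) fun t y => christoffel (G t) i j k y :=
  Represents.smul (1 / 2) <| Represents.sum fun l => (hgi k l).mul <|
    (((hg j l).pd hS hU i).add ((hg i l).pd hS hU j)).sub ((hg i j).pd hS hU l)

theorem represents_riem (i j k l : Fin n) :
    Represents (curv (koszul (spaceDeriv hS) g gi) (spaceDeriv hS) i j k l)
      fun t y => riem (G t) i j k l y := by
  have h := represents_christoffel hS hU hg hgi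
  exact (((h j k l).pd hS hU i).sub ((h i k l).pd hS hU j)).add <| Represents.sum fun m =>
    ((h j k m).mul (h i m l)).sub ((h i k m).mul (h j m l))

theorem represents_ric (j k : Fin n) :
    Represents (ricci (spaceDeriv hS) (koszul (spaceDeriv hS) g gi) j k)
      fun t y => ric (G t) j k y :=
  Represents.sum fun p => represents_riem hS hU hg hgi p j k p

theorem represents_ricMixed (i l : Fin n) :
    Represents (ricciUp (spaceDeriv hS) gi (koszul (spaceDeriv hS) g gi) i l)
      fun t y => ricMixed (G t) i l y :=
  Represents.sum fun m => (hgi l m).mul (represents_ric hS hU hg hgi i m)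

theorem represents_scal :
    Represents (scalarCurv (spaceDeriv hS) gi (koszul (spaceDeriv hS) g gi))
      fun t y => scal (G t) y :=
  Represents.sum fun j => Represents.sum fun k =>
    (hgi j k).mul (represents_ric hS hU hg hgi j k)

theorem represents_gradScal (l : Fin n) :
    Represents (∑ m, gi l m * spaceDeriv hS m
        (scalarCurv (spaceDeriv hS) gi (koszul (spaceDeriv hS) g gi)))
      fun t y => gradScal (G t) l y :=
  Represents.sum fun m => (hgi l m).mul ((represents_scal hS hU hg hgi).pd hS hU m)

theorem represents_covVec {V : Fin n → smoothFun (U ×ˢ J)}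
    {V' : ℝ → Fin n → EuclideanSpace ℝ (Fin n) → ℝ}
    (hV : ∀ l, Represents (V l) fun t y => V' t l y) (i l : Fin n) :
    Represents (((CovDeriv.base (spaceDeriv hS)).upper (koszul (spaceDeriv hS) g gi)).D i V l)
      fun t y => covVec (G t) (V' t) i l y :=
  ((hV l).pd hS hU i).add <| Represents.sum fun m =>
    (represents_christoffel hS hU hg hgi i m l).mul (hV m)

theorem represents_cov02 {B : Fin n → Fin n → smoothFun (U ×ˢ J)}
    {B' : ℝ → Fin n → Fin n → EuclideanSpace ℝ (Fin n) → ℝ}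
    (hB : ∀ j k, Represents (B j k) fun t y => B' t j k y) (i j k : Fin n) :
    Represents ((CovDeriv.lower2 (spaceDeriv hS) (koszul (spaceDeriv hS) g gi)).D i B j k)
      fun t y => cov02 (G t) (B' t) i j k y := by
  have h := represents_christoffel hS hU hg hgi
  have h1 := (((hB j k).pd hS hU i).sub (Represents.sum fun m => (h i j m).mul (hB m k))).sub
    (Represents.sum fun m => (h i k m).mul (hB j m))
  intro p
  rw [CovDeriv.lower2_apply, sub_right_comm]
  exact h1 p

theorem represents_cov11 {B : Fin n → Fin n → smoothFun (U ×ˢ J)}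
    {B' : ℝ → Fin n → Fin n → EuclideanSpace ℝ (Fin n) → ℝ}
    (hB : ∀ j l, Represents (B j l) fun t y => B' t j l y) (i j l : Fin n) :
    Represents ((((CovDeriv.base (spaceDeriv hS)).upper (koszul (spaceDeriv hS) g gi)).lower
        (koszul (spaceDeriv hS) g gi)).D i B j l)
      fun t y => cov11 (G t) (B' t) i j l y := by
  have h := represents_christoffel hS hU hg hgi
  have h1 := (((hB j l).pd hS hU i).sub (Represents.sum fun m => (h i j m).mul (hB m l))).add
    (Represents.sum fun m => (h i m l).mul (hB j m))
  intro p
  simp only [CovDeriv.lower_apply, CovDeriv.upper_apply, CovDeriv.base_apply, Pi.sub_apply,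
    Finset.sum_apply, Pi.smul_apply, smul_eq_mul]
  rw [add_sub_right_comm]
  exact h1 p

theorem represents_cov21 {B : Fin n → Fin n → Fin n → smoothFun (U ×ˢ J)}
    {B' : ℝ → Fin n → Fin n → Fin n → EuclideanSpace ℝ (Fin n) → ℝ}
    (hB : ∀ j k l, Represents (B j k l) fun t y => B' t j k l y) (i j k l : Fin n) :
    Represents (((((CovDeriv.base (spaceDeriv hS)).upper (koszul (spaceDeriv hS) g gi)).lower
        (koszul (spaceDeriv hS) g gi)).lower (koszul (spaceDeriv hS) g gi)).D i B j k l)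
      fun t y => cov21 (G t) (B' t) i j k l y := by
  have h := represents_christoffel hS hU hg hgi
  have h1 := ((((hB j k l).pd hS hU i).sub (Represents.sum fun m => (h i j m).mul (hB m k l))).sub
    (Represents.sum fun m => (h i k m).mul (hB j m l))).add
    (Represents.sum fun m => (h i m l).mul (hB j k m))
  intro p
  simp only [CovDeriv.lower_apply, CovDeriv.upper_apply, CovDeriv.base_apply, Pi.sub_apply,
    Finset.sum_apply, Pi.smul_apply, smul_eq_mul]
  rw [add_sub_right_comm, add_sub_right_comm, sub_right_comm]
  exact h1 p

theorem represents_covUpRic (l i k : Fin n) :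
    Represents (∑ m, gi l m * dRicci (spaceDeriv hS) (koszul (spaceDeriv hS) g gi) m i k)
      fun t y => covUpRic (G t) l i k y :=
  Represents.sum fun m => (hgi l m).mul <|
    represents_cov02 hS hU hg hgi (B' := fun t => ric (G t)) (represents_ric hS hU hg hgi) m i k

theorem represents_lapRic (i l : Fin n) :
    let Γ := koszul (spaceDeriv hS) g gi
    Represents (metricTrace gi (fun p q =>
        ((((CovDeriv.base (spaceDeriv hS)).upper Γ).lower Γ).lower Γ).D p
          (fun q => (((CovDeriv.base (spaceDeriv hS)).upper Γ).lower Γ).D q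
            (ricciUp (spaceDeriv hS) gi Γ)) q i l))
      fun t y => lapRic (G t) i l y :=
  Represents.sum fun p => Represents.sum fun q => (hgi p q).mul <|
    represents_cov21 hS hU hg hgi (B' := fun t => cov11 (G t) (ricMixed (G t)))
      (represents_cov11 hS hU hg hgi (B' := fun t => ricMixed (G t))
        (represents_ricMixed hS hU hg hgi)) p q i l

end Geometry

end Represents

/-! ### The curvature of the space-time connection -/

section SpacetimeAlgebra

variable {n : ℕ} {A : Type*} [CommRing A] [Algebra ℝ A]

/-- The coefficients of a space-time connection with spatial coefficients `Γ`, mixed coefficients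
`P` and purely temporal coefficients `N`. -/
def stCoeff (Γ : Fin n → Fin n → Fin n → A) (P : Fin n → Fin n → A) (N : Fin n → A)
    (a b c : Fin (n + 1)) : A :=
  Fin.cases 0
    (fun k => Fin.cases
      (Fin.cases (N k) (fun j => P j k) b)
      (fun i => Fin.cases (P i k) (fun j => Γ i j k) b) a) c

/-- The coordinate derivations on space-time. -/
def stDeriv (δ : Derivation ℝ A A) (d : Fin n → Derivation ℝ A A) (a : Fin (n + 1)) :
    Derivation ℝ A A :=
  Fin.cases δ d a

variable (Γ : Fin n → Fin n → Fin n → A) (P : Fin n → Fin n → A) (N : Fin n → A)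
  (δ : Derivation ℝ A A) (d : Fin n → Derivation ℝ A A)

@[simp] theorem stDeriv_zero : stDeriv δ d 0 = δ := rfl

@[simp] theorem stDeriv_succ (i : Fin n) : stDeriv δ d i.succ = d i := rfl

@[simp] theorem stCoeff_time (a b : Fin (n + 1)) : stCoeff Γ P N a b 0 = 0 := rfl

@[simp] theorem stCoeff_zero_zero (k : Fin n) : stCoeff Γ P N 0 0 k.succ = N k := rfl

@[simp] theorem stCoeff_zero_succ (j k : Fin n) : stCoeff Γ P N 0 j.succ k.succ = P j k := rfl

@[simp] theorem stCoeff_succ_zero (i k : Fin n) : stCoeff Γ P N i.succ 0 k.succ = P i k := rfl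

@[simp] theorem stCoeff_succ_succ (i j k : Fin n) :
    stCoeff Γ P N i.succ j.succ k.succ = Γ i j k := rfl

theorem curv_stCoeff_space (i j k l : Fin n) :
    curv (stCoeff Γ P N) (stDeriv δ d) i.succ j.succ k.succ l.succ = curv Γ d i j k l := by
  simp [curv, Fin.sum_univ_succ]

theorem curv_stCoeff_time (a b c : Fin (n + 1)) :
    curv (stCoeff Γ P N) (stDeriv δ d) a b c 0 = 0 := by
  simp [curv]

/-- The two covariant derivatives contain Γ_{ij}^m P_m^l and Γ_{ji}^m P_m^l, which are absent from
the curvature formula; they cancel by symmetry of Γ. -/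
theorem curv_stCoeff_space_space_time (hΓ : ∀ i j k, Γ i j k = Γ j i k) (i j l : Fin n) :
    let c := ((CovDeriv.base d).upper Γ).lower Γ
    curv (stCoeff Γ P N) (stDeriv δ d) i.succ j.succ 0 l.succ = c.D i P j l - c.D j P i l := by
  simp only [curv, Fin.sum_univ_succ, stDeriv_succ, stCoeff_succ_zero, stCoeff_succ_succ,
    stCoeff_time, CovDeriv.lower_apply, CovDeriv.upper_apply, CovDeriv.base_apply, Pi.sub_apply,
    Finset.sum_apply, Pi.smul_apply, smul_eq_mul, Finset.sum_sub_distrib, hΓ j i,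
    mul_comm (P _ _)]
  ring

theorem curv_stCoeff_space_time_space (i k l : Fin n) :
    curv (stCoeff Γ P N) (stDeriv δ d) i.succ 0 k.succ l.succ
      = (((CovDeriv.base d).upper Γ).lower Γ).D i P k l - δ (Γ i k l) := by
  simp only [curv, Fin.sum_univ_succ, stDeriv_succ, stDeriv_zero, stCoeff_succ_succ,
    stCoeff_zero_succ, stCoeff_time, CovDeriv.lower_apply, CovDeriv.upper_apply,
    CovDeriv.base_apply, Pi.sub_apply, Finset.sum_apply, Pi.smul_apply, smul_eq_mul,
    Finset.sum_sub_distrib, mul_comm (P k _)]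
  ring

theorem curv_stCoeff_space_time_time (i l : Fin n) :
    curv (stCoeff Γ P N) (stDeriv δ d) i.succ 0 0 l.succ
      = ((CovDeriv.base d).upper Γ).D i N l - δ (P i l) - ∑ m, P i m * P m l := by
  simp only [curv, Fin.sum_univ_succ, stDeriv_succ, stDeriv_zero, stCoeff_succ_succ,
    stCoeff_zero_succ, stCoeff_zero_zero, stCoeff_succ_zero, stCoeff_time, CovDeriv.upper_apply,
    CovDeriv.base_apply, smul_eq_mul, Finset.sum_sub_distrib, mul_comm (N _)]
  ring

end SpacetimeAlgebra

/-! ### Passing from the algebraic curvature to `stRiem` -/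

section SpacetimeEval

variable {n : ℕ} {U : Set (EuclideanSpace ℝ (Fin n))} {T : EReal}

/-- The curvature of the space-time connection, evaluated through the algebra of smooth functions
on `U × [0, T)`. -/
theorem stRiem_eq_evalAt {G : ℝ → EuclideanSpace ℝ (Fin n) → Matrix (Fin n) (Fin n) ℝ}
    {g gi : Matrix (Fin n) (Fin n) (smoothFun (U ×ˢ timeInterval T))}
    (hS : UniqueDiffOn ℝ (U ×ˢ timeInterval T)) (hU : IsOpen U)
    (hg : ∀ i j, Represents (g i j) fun t y => G t y i j)
    (hgi : ∀ i j, Represents (gi i j) fun t y => (G t y)⁻¹ i j)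
    {τ t : ℝ} (hτ : τ ∈ timeInterval T) (ht : t ∈ timeInterval (T - (τ : EReal)))
    {y : EuclideanSpace ℝ (Fin n)} (hy : y ∈ U) (a b c e : Fin (n + 1)) :
    let d := spaceDeriv hS
    let Γ := koszul d g gi
    stRiem T G τ a b c e (y, t)
      = evalAt (S := U ×ˢ timeInterval T) ⟨(y, t + τ), hy, add_mem_timeInterval hτ.1 ht⟩
        (curv (stCoeff Γ (-ricciUp d gi Γ)
            (-((1 / 2 : ℝ) • fun l => ∑ m, gi l m * d m (scalarCurv d gi Γ))))
          (stDeriv (timeDeriv hS) d) a b c e) := by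
  intro d Γ
  set C := stCoeff Γ (-ricciUp d gi Γ)
    (-((1 / 2 : ℝ) • fun l => ∑ m, gi l m * d m (scalarCurv d gi Γ)))
  set p : (U ×ˢ timeInterval T : Set _) := ⟨(y, t + τ), hy, add_mem_timeInterval hτ.1 ht⟩
  -- The algebra lives over [0, T), whereas `stGamma` evaluates at its own time plus τ; the argument
  -- s - τ undoes this shift.
  have hC (a b c : Fin (n + 1)) : Represents (C a b c) fun s z => stGamma G τ a b c (z, s - τ) := by
    intro q
    cases c using Fin.cases with
    | zero => exact (map_zero (evalAt q)).symm
    | succ k =>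
      cases a using Fin.cases with
      | zero =>
        cases b using Fin.cases with
        | zero =>
          have h := ((represents_gradScal hS hU hg hgi k).smul (1 / 2)).neg q
          simp only [C, stCoeff_zero_zero]
          refine Eq.trans ?_ h
          simp only [stGamma, Fin.cases_zero, Fin.cases_succ, sub_add_cancel, neg_mul]
        | succ j =>
          have h := (represents_ricMixed hS hU hg hgi j k).neg q
          simp only [C, stCoeff_zero_succ]
          refine Eq.trans ?_ h
          simp only [stGamma, Fin.cases_zero, Fin.cases_succ, sub_add_cancel]
      | succ i =>
        cases b using Fin.cases with
        | zero =>
          have h := (represents_ricMixed hS hU hg hgi i k).neg q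
          simp only [C, stCoeff_succ_zero]
          refine Eq.trans ?_ h
          simp only [stGamma, Fin.cases_zero, Fin.cases_succ, sub_add_cancel]
        | succ j =>
          have h := represents_christoffel hS hU hg hgi i j k q
          simp only [C, stCoeff_succ_succ]
          refine Eq.trans ?_ h
          simp only [stGamma, Fin.cases_succ, sub_add_cancel]
  have hval (a b c : Fin (n + 1)) : stGamma G τ a b c (y, t) = evalAt p (C a b c) := by
    have h := hC a b c p
    simpa only [p, add_sub_cancel_right] using h
  have hder (a' a b c : Fin (n + 1)) : stPd (timeInterval (T - (τ : EReal))) a' (stGamma G τ a b c)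
      (y, t) = evalAt p (stDeriv (timeDeriv hS) d a' (C a b c)) := by
    cases a' using Fin.cases with
    | zero =>
      have h := (hC a b c).hasDerivWithinAt hS hy (add_mem_timeInterval hτ.1 ht)
      -- The translation s ↦ s + τ maps [0, T - τ) into [0, T) with derivative 1, so the one-sided
      -- time derivatives agree.
      have h1 := HasDerivWithinAt.scomp t h
        ((hasDerivWithinAt_id t (timeInterval (T - (τ : EReal)))).add_const τ)
        (fun s hs => add_mem_timeInterval hτ.1 hs)
      rw [one_smul] at h1
      have h2 := h1.derivWithin (timeInterval_uniqueDiffOn _ t ht)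
      refine Eq.trans ?_ h2
      simp only [stPd, Fin.cases_zero]
      congr 1
      funext s
      simp
    | succ i =>
      have h := (hC a b c).pd hS hU i p
      refine Eq.trans ?_ h
      simp only [stPd, Fin.cases_succ, p, add_sub_cancel_right]
  simp only [stRiem, curvatureCoeff, curv, map_add, map_sub, map_sum, map_mul, hval, hder]

end SpacetimeEval

end RicciSpacetime

end

/-! ### The curvature components under the Ricci flow -/

open RicciSpacetime in
theorem theorem2p2 (n : ℕ) {M : Type*} [TopologicalSpace M]
    [ChartedSpace (EuclideanSpace ℝ (Fin n)) M] [IsManifold (𝓡 n) ∞ M]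
    (T : EReal) (g : ℝ → RicciSpacetime.SmoothMetric n M)
    (hg : RicciSpacetime.IsRicciFlow T g)
    (τ : ℝ) (hτ : τ ∈ RicciSpacetime.timeInterval T)
    (e : OpenPartialHomeomorph M (EuclideanSpace ℝ (Fin n)))
    (he : e ∈ IsManifold.maximalAtlas (𝓡 n) ∞ M)
    (x : M) (hx : x ∈ e.source)
    (t : ℝ) (ht : t ∈ RicciSpacetime.timeInterval (T - (τ : EReal))) :
    let G : ℝ → EuclideanSpace ℝ (Fin n) → Matrix (Fin n) (Fin n) ℝ :=
      fun s => RicciSpacetime.metricCoeff e (g s)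
    let Rt : Fin (n + 1) → Fin (n + 1) → Fin (n + 1) → Fin (n + 1) → ℝ :=
      fun a b c d => RicciSpacetime.stRiem T G τ a b c d (e x, t)
    let H : EuclideanSpace ℝ (Fin n) → Matrix (Fin n) (Fin n) ℝ := G (t + τ)
    let Ric : Fin n → Fin n → ℝ := fun i l => RicciSpacetime.ricMixed H i l (e x)
    -- the spatial components
    (∀ i j k l : Fin n,
      Rt i.succ j.succ k.succ l.succ = RicciSpacetime.riem H i j k l (e x)) ∧
    (∀ i j k : Fin n, Rt i.succ j.succ k.succ 0 = 0) ∧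
    -- the mixed components
    (∀ i j l : Fin n,
      Rt i.succ j.succ 0 l.succ =
        -RicciSpacetime.cov11 H (RicciSpacetime.ricMixed H) i j l (e x)
          + RicciSpacetime.cov11 H (RicciSpacetime.ricMixed H) j i l (e x)) ∧
    (∀ i k l : Fin n,
      Rt i.succ 0 k.succ l.succ =
        -RicciSpacetime.covUpRic H l i k (e x)
          + RicciSpacetime.cov11 H (RicciSpacetime.ricMixed H) k i l (e x)) ∧
    -- the components with two time indices
    (∀ i l : Fin n,
      Rt i.succ 0 0 l.succ =
        RicciSpacetime.lapRic H i l (e x)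
          - (1 / 2) * RicciSpacetime.covVec H (RicciSpacetime.gradScal H) i l (e x)
          + 2 * ∑ m, ∑ p, ∑ q,
              (H (e x))⁻¹ l m * RicciSpacetime.riem H p i m q (e x) * Ric q p
          - ∑ m, Ric m l * Ric i m) ∧
    (∀ i l : Fin n,
      Rt i.succ 0 0 l.succ =
        derivWithin (fun s => RicciSpacetime.ricMixed (G s) i l (e x))
            (RicciSpacetime.timeInterval T) (t + τ)
          - (1 / 2) * RicciSpacetime.covVec H (RicciSpacetime.gradScal H) i l (e x)
          - ∑ m, Ric i m * Ric m l) := by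
  intro G Rt H Ric
  have hU : IsOpen e.target := e.open_target
  have hJ := timeInterval_uniqueDiffOn T
  have hS : UniqueDiffOn ℝ (e.target ×ˢ timeInterval T) := hU.uniqueDiffOn.prod hJ
  have hcl : e.target ×ˢ timeInterval T ⊆ closure (interior (e.target ×ˢ timeInterval T)) := by
    rw [interior_prod_eq, closure_prod_eq, hU.interior_eq]
    exact Set.prod_mono subset_closure (timeInterval_subset_closure T)
  have hy : e x ∈ e.target := e.map_source hx
  have hs : t + τ ∈ timeInterval T := add_mem_timeInterval hτ.1 ht
  let gA : Matrix (Fin n) (Fin n) (smoothFun (e.target ×ˢ timeInterval T)) :=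
    Matrix.of fun i j => smoothRestrict (fun p => metricCoeff e (g p.2) p.1 i j)
      (hg.smooth e he i j)
  have hgA (i j : Fin n) : Represents (gA i j) fun t y => G t y i j := fun _ => rfl
  obtain ⟨gi, hinv, hgi⟩ := exists_smooth_inverse hgA
    fun t _ y hy => metricCoeff_det_ne_zero he (g t) hy
  let d := spaceDeriv hS
  let δ := timeDeriv hS
  let Γ := koszul d gA gi
  have hLC : IsLeviCivita d gA gi Γ := isLeviCivita_koszul
    (fun i j a => dirDeriv_comm hS hcl _ _ a)
    (fun i j => smoothFun_ext fun p => metricCoeff_symm e (g p.1.2) p.1.1 i j) hinv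
  have hδ (i : Fin n) (a) : δ (d i a) = d i (δ a) := dirDeriv_comm hS hcl _ _ a
  have hflow (i j : Fin n) : δ (gA i j) = -2 * ricci d Γ i j := smoothFun_ext fun p => by
    have h1 := (hgA i j).hasDerivWithinAt hS p.2.1 p.2.2
    have h2 := hg.evolution e he p.1.1 p.2.1 p.1.2 p.2.2 i j
    have h3 := represents_ric hS hU hgA hgi i j p
    -- Derivatives within [0, T) are unique, so the algebraic ∂_t g is the one prescribed by the
    -- flow.
    have h4 := (hJ _ p.2.2).eq_deriv _ h1 h2
    refine h4.trans ?_
    rw [map_mul, map_neg, map_ofNat, ← h3]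
  have hRt (a b c f : Fin (n + 1)) := stRiem_eq_evalAt hS hU hgA hgi hτ ht hy a b c f
  have hc11 (i j l : Fin n) := (represents_cov11 hS hU hgA hgi (B' := fun t => ricMixed (G t))
    (represents_ricMixed hS hU hgA hgi) i j l).eq hy hs
  have hRic (i l : Fin n) := (represents_ricMixed hS hU hgA hgi i l).eq hy hs
  have hN (i l : Fin n) := (represents_covVec hS hU hgA hgi (V' := fun t => gradScal (G t))
    (represents_gradScal hS hU hgA hgi) i l).eq hy hs
  -- The common core of both formulas for R̃_{i00}^l, with the time derivative of R_i^l still taken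
  -- in the algebra.
  have htt (i l : Fin n) : Rt i.succ 0 0 l.succ =
      evalAt (S := e.target ×ˢ timeInterval T) ⟨(e x, t + τ), hy, hs⟩ (δ (ricciUp d gi Γ i l))
        - (1 / 2) * covVec H (gradScal H) i l (e x) - ∑ m, Ric i m * Ric m l := by
    refine (hRt _ _ _ _).trans ?_
    rw [curv_stCoeff_space_time_time, map_neg, CovDeriv.map_real_smul, hN]
    have e1 (r : ℝ) (p) (a : smoothFun (e.target ×ˢ timeInterval T)) :
        evalAt p (r • a) = r * evalAt p a := rfl
    simp only [Ric, H, hRic, Pi.neg_apply, Pi.smul_apply, map_sub, map_neg, map_sum, map_mul, e1,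
      neg_mul_neg]
    ring
  refine ⟨fun i j k l => ?_, fun i j k => ?_, fun i j l => ?_, fun i k l => ?_, fun i l => ?_,
    fun i l => ?_⟩
  · refine (hRt _ _ _ _).trans ?_
    rw [curv_stCoeff_space]
    exact ((represents_riem hS hU hgA hgi i j k l).eq hy hs).symm
  · refine (hRt _ _ _ _).trans ?_
    rw [curv_stCoeff_time, map_zero]
  · refine (hRt _ _ _ _).trans ?_
    rw [curv_stCoeff_space_space_time _ _ _ _ _ hLC.symm]
    simp only [map_neg, Pi.neg_apply, map_sub]
    rw [← hc11, ← hc11]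
    ring
  · refine (hRt _ _ _ _).trans ?_
    -- In ∇_i P_k^l - ∂_t Γ_{ik}^l the two copies of ∇_i R_k^l cancel.
    have h := hLC.flow_connection_mixed hδ hflow i k l
    have h' := (represents_covUpRic hS hU hgA hgi l i k).eq hy hs
    rw [curv_stCoeff_space_time_space, h, map_neg, h', hc11, Pi.neg_apply, Pi.neg_apply, ← map_neg,
      ← map_add]
    congr 1
    ring
  · rw [htt, hLC.flow_ricciUp hδ hflow, map_add, ← (represents_lapRic hS hU hgA hgi i l).eq hy hs]
    have h1 (m p q : Fin n) := (represents_riem hS hU hgA hgi p i m q).eq hy hs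
    have h2 (m : Fin n) := (hgi l m).eq hy hs
    simp only [map_mul, map_sum, map_ofNat, d, Γ, ← hRic, ← h1, ← h2]
    simp only [Ric, H, mul_comm (ricMixed _ i _ _)]
    ring
  · rw [htt]
    have h := ((represents_ricMixed hS hU hgA hgi i l).hasDerivWithinAt hS hy hs).derivWithin
      (hJ _ hs)
    rw [← h]
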